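/- **Setting.** Norms are Euclidean on vectors and Frobenius on matrices; $\|(\xi^y,\xi^z)\|^2=\|\xi^y\|^2+\|\xi^z\|^2$; $A\le B$ for square matrices means $v^TAv\le v^TBv$ for all $v$ (the Loewner order on symmetric matrices). Let $\mathcal G$ be a connected undirected graph on $\{1,\dots,N\}$ and $P=(p_{ij})\in\mathbb R^{N\times N}$ a symmetric matrix with non-negative entries and $P\mathbf 1=\mathbf 1$, with $p_{ij}>0$ for $i\ne j$ only if $\{i,j\}$ is an edge of $\mathcal G$, and with $\lim_{k\to\infty}P^k=\frac1N\mathbf 1\mathbf 1^T$. Let $f_1,\dots,f_N:\mathbb R^n\to\mathbb R$, $\overline f=\frac1N\sum_i f_i$, and let $x^*$ be the minimizer of $\overline f$. Fix one of the three choices $h_i(x)=\nabla^2f_i(x)$ for all $i$, $h_i(x)=\mathrm{diag}[\nabla^2f_i(x)]$ for all $i$, or $h_i(x)=I$ for all $i$, and put $g_i(x)=h_i(x)x-\nabla f_i(x)$. Put $f_i'(x)=f_i(x+x^*)$ and let $h_i',g_i'$ be formed from $f_i'$ in the same way. For $\boldsymbol x=(x_1,\dots,x_N)\in\mathbb R^{nN}$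 let $\overline{h'}(\boldsymbol x)=\frac1N\sum_ih_i'(x_i)$, $\overline{g'}(\boldsymbol x)=\frac1N\sum_ig_i'(x_i)$, $\psi(\boldsymbol x)=\overline{h'}(\boldsymbol x)^{-1}\overline{g'}(\boldsymbol x)$. For $c>0$ let $[z]_c=z$ if $z\ge\frac c2I$ and $[z]_c=\frac c2I$ otherwise, and for $\xi=(\xi^y,\xi^z)\in\mathbb R^n\times\mathbb R^{n\times n}$ let $\phi_x(\boldsymbol x,\xi)\in\mathbb R^{nN}$ have the $i$-th block $$-x_i-x^*+\big[\xi^z+\overline{h'}(\boldsymbol x)\big]_c^{-1}\big(\xi^y+\overline{g'}(\boldsymbol x)+\overline{h'}(\boldsymbol x)x^*\big).$$ **Assumptions.** 1. The $f_i$ are of class $C^3$, and there are $c,m>0$ with $cI\le\nabla^2\overline f(x)\le mI$ for all $x\in\mathbb R^n$. 2. With the same $c,m$, there are $m_g,a_g,a_h,a_\psi>0$ such that for all $i$, all $x,x'\in\mathbb R^n$ and all $\boldsymbol x,\boldsymbol x'\in\mathbb R^{nN}$: $cI\le\overline{h'}(\boldsymbol x)\le mI$, $\|\overline{g'}(\boldsymbol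 x)\|\le m_g$, $\|g_i'(x)-g_i'(x')\|\le a_g\|x-x'\|$, $\|h_i'(x)-h_i'(x')\|\le a_h\|x-x'\|$, $\|\psi(\boldsymbol x)-\psi(\boldsymbol x')\|\le a_\psi\|\boldsymbol x-\boldsymbol x'\|$. 3. There are $a_\xi,r_0>0$ such that, whenever $\|\xi\|\le r_0$ and $x^{eq}\in\mathbb R^n$ satisfies $\phi_x(\mathbf 1_N\otimes x^{eq},\xi)=0$ (for small $\xi$ there is exactly one such $x^{eq}=x^{eq}(\xi)$, and $x^{eq}(0)=0$), one has $\|\phi_x(\boldsymbol x+\mathbf 1_N\otimes x^{eq},\xi)-\phi_x(\boldsymbol x,0)\|\le a_\xi\|\xi\|\,\|\boldsymbol x\|$ for all $\boldsymbol x\in\mathbb R^{nN}$. **Algorithm (Newton–Raphson consensus).** Start from arbitrary $x_i(0),y_i(0),v_i(0)\in\mathbb R^n$ and $z_i(0),w_i(0)\in\mathbb R^{n\times n}$, and for $k\ge1$ set $$\begin{aligned}x_i(k)&=(1-\varepsilon)x_i(k-1)+\varepsilon[z_i(k-1)]_c^{-1}y_i(k-1),\\ y_i(k)&=\textstyle\sum_jp_{ij}\big(y_j(k-1)+g_j(x_j(k-1))-v_j(k-1)\big),\\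 z_i(k)&=\textstyle\sum_jp_{ij}\big(z_j(k-1)+h_j(x_j(k-1))-w_j(k-1)\big),\end{aligned}$$ $v_i(k)=g_i(x_i(k-1))$, $w_i(k)=h_i(x_i(k-1))$. Let $\xi^y=\frac1N\sum_i(y_i(0)-v_i(0))$ and $\xi^z=\frac1N\sum_i(z_i(0)-w_i(0))$. **Theorem.** Under Assumptions 1–3 there are $a,r,\overline\varepsilon>0$ and a continuously differentiable $\Psi:\mathbb R^n\times\mathbb R^{n\times n}\to\mathbb R^n$ with $$\|\Psi(\xi^y,\xi^z)-x^*\|\le a\big(\|\xi^y\|+\|\xi^z\|\big)\quad\text{for all }(\xi^y,\xi^z),$$ such that for every $\varepsilon\in(0,\overline\varepsilon)$ and all initial conditions with $\|\xi^y\|+\|\xi^z\|\le r$ the local estimates converge exponentially to $\Psi(\xi^y,\xi^z)$: $\lim_{k\to\infty}x_i(k)=\Psi(\xi^y,\xi^z)$ for all $i$. More precisely, for every $\varepsilon\in(0,\overline\varepsilon)$ there is $\gamma\in(0,1)$ such that for all those initial conditions there is $C$ with $\|x_i(k)-\Psi(\xi^y,\xi^z)\|\le C\gamma^k$ for all $i$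 and $k$. -/

import Mathlib

open Filter Topology
open scoped Matrix.Norms.Frobenius

namespace NRC

noncomputable section

/-- `ℝⁿ` with the Euclidean norm. -/
abbrev Vec (n : ℕ) := EuclideanSpace ℝ (Fin n)

/-- `ℝ^{n × n}`, normed by the Frobenius norm (scoped instance opened above). -/
abbrev Mat (n : ℕ) := Matrix (Fin n) (Fin n) ℝ

/-- `ℝ^{nN}`: the stacked vector `(x₁, …, x_N)`, with the Euclidean norm. -/
abbrev Stack (n N : ℕ) := PiLp 2 (fun _ : Fin N => Vec n)

/-- The product of a square matrix with a vector. -/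
def mv {n : ℕ} (A : Mat n) (x : Vec n) : Vec n := Matrix.toEuclideanLin A x

/-- The stacked vector all of whose blocks are equal to `x`. -/
def ones {n : ℕ} (N : ℕ) (x : Vec n) : Stack n N := WithLp.toLp 2 (fun _ => x)

/-- `A ≤ B` in the sense of quadratic forms (the Loewner order on symmetric matrices). -/
def QuadLE {n : ℕ} (A B : Mat n) : Prop :=
  ∀ v : Fin n → ℝ, v ⬝ᵥ (A.mulVec v) ≤ v ⬝ᵥ (B.mulVec v)

/-- A symmetric stochastic matrix consistent with the connected undirected graph `G` whose powers
converge to the averaging matrix. Self-weights `P i i` are unrestricted. -/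
structure IsAverageConsensus {N : ℕ} (G : SimpleGraph (Fin N)) (P : Matrix (Fin N) (Fin N) ℝ) :
    Prop where
  connected : G.Connected
  nonneg : ∀ i j, 0 ≤ P i j
  row_sum : ∀ i, ∑ j, P i j = 1
  symm : P.IsSymm
  consistent : ∀ i j, i ≠ j → 0 < P i j → G.Adj i j
  tendsto_pow : Tendsto (fun k : ℕ => P ^ k) atTop (𝓝 (Matrix.of fun _ _ => (1 : ℝ) / N))

/-- The Hessian matrix: the Jacobian matrix of the gradient. -/
def hessian {n : ℕ} (f : Vec n → ℝ) (x : Vec n) : Mat n :=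
  Matrix.of fun i j => (fderiv ℝ (gradient f) x (EuclideanSpace.single j 1)) i

/-- The three admissible choices of the curvature matrices. -/
inductive Kind
  | newton
  | jacobi
  | gradientDescent

/-- The curvature matrix of a local cost: its Hessian, the diagonal of its Hessian, or `I`. -/
def hLoc {n : ℕ} (κ : Kind) (f : Vec n → ℝ) (x : Vec n) : Mat n :=
  match κ with
  | Kind.newton => hessian f x
  | Kind.jacobi => Matrix.diagonal (hessian f x).diag
  | Kind.gradientDescent => 1

/-- `g(x) = h(x) x - ∇f(x)`. -/
def gLoc {n : ℕ} (κ : Kind) (f : Vec n → ℝ) (x : Vec n) : Vec n :=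
  mv (hLoc κ f x) x - gradient f x

/-- The global cost, the average of the local ones. -/
def avgCost {n N : ℕ} (f : Fin N → Vec n → ℝ) (x : Vec n) : ℝ :=
  (1 / (N : ℝ)) * ∑ i, f i x

/-- The translated local costs `x ↦ f i (x + a)`. -/
def shiftCost {n N : ℕ} (f : Fin N → Vec n → ℝ) (a : Vec n) : Fin N → Vec n → ℝ :=
  fun i x => f i (x + a)

/-- The average of the curvature matrices, each evaluated at its own block. -/
def hBar {n N : ℕ} (κ : Kind) (f : Fin N → Vec n → ℝ) (X : Stack n N) : Mat n :=
  (1 / (N : ℝ)) • ∑ i, hLoc κ (f i) (X i)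

/-- The average of the vectors `g i`, each evaluated at its own block. -/
def gBar {n N : ℕ} (κ : Kind) (f : Fin N → Vec n → ℝ) (X : Stack n N) : Vec n :=
  (1 / (N : ℝ)) • ∑ i, gLoc κ (f i) (X i)

/-- `ψ(X) = hBar(X)⁻¹ gBar(X)`. -/
def psi {n N : ℕ} (κ : Kind) (f : Fin N → Vec n → ℝ) (X : Stack n N) : Vec n :=
  mv (hBar κ f X)⁻¹ (gBar κ f X)

open Classical in
/-- The thresholding `[z]_c`: `z` if `z ≥ (c/2) I`, and `(c/2) I` otherwise. -/
def thr {n : ℕ} (c : ℝ) (z : Mat n) : Mat n :=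
  if QuadLE ((c / 2) • (1 : Mat n)) z then z else (c / 2) • (1 : Mat n)

/-- The perturbed multi-agent Newton-Raphson vector field `φ_x(X, ξ)`, for the same perturbation
`ξ = (ξy, ξz)` at every agent. Here `f` are the translated costs, whose average is minimal at `0`,
and `xstar` is the minimizer of the original global cost. -/
def phi {n N : ℕ} (κ : Kind) (f : Fin N → Vec n → ℝ) (c : ℝ) (xstar : Vec n)
    (X : Stack n N) (ξy : Vec n) (ξz : Mat n) : Stack n N :=
  WithLp.toLp 2 fun i =>
    - X i - xstar +
      mv (thr c (ξz + hBar κ f X))⁻¹ (ξy + (gBar κ f X + mv (hBar κ f X) xstar))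

/-- `C³` local costs, and a global cost with `0 < c I ≤ ∇² ≤ m I`. -/
structure Convexity {n N : ℕ} (f : Fin N → Vec n → ℝ) (c m : ℝ) : Prop where
  smooth : ∀ i, ContDiff ℝ 3 (f i)
  c_pos : 0 < c
  m_pos : 0 < m
  hess_lower : ∀ x, QuadLE (c • (1 : Mat n)) (hessian (avgCost f) x)
  hess_upper : ∀ x, QuadLE (hessian (avgCost f) x) (m • (1 : Mat n))

/-- The global bounds and Lipschitz conditions, on the translated local costs `f`. -/
def GlobalProperties {n N : ℕ} (κ : Kind) (f : Fin N → Vec n → ℝ) (c m : ℝ) : Prop :=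
  ∃ mg ag ah aψ : ℝ, 0 < mg ∧ 0 < ag ∧ 0 < ah ∧ 0 < aψ ∧
    (∀ X : Stack n N,
      QuadLE (c • (1 : Mat n)) (hBar κ f X) ∧ QuadLE (hBar κ f X) (m • (1 : Mat n))) ∧
    (∀ X : Stack n N, ‖gBar κ f X‖ ≤ mg) ∧
    (∀ i x x', ‖gLoc κ (f i) x - gLoc κ (f i) x'‖ ≤ ag * ‖x - x'‖) ∧
    (∀ i x x', ‖hLoc κ (f i) x - hLoc κ (f i) x'‖ ≤ ah * ‖x - x'‖) ∧
    (∀ X X' : Stack n N, ‖psi κ f X - psi κ f X'‖ ≤ aψ * ‖X - X'‖)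

/-- The global Lipschitz condition on the perturbation: with `x_eq(ξ)` the equilibrium of
`φ_x(·, ξ)`, the field `φ'_x(X, ξ) = φ_x(X + 1 ⊗ x_eq(ξ), ξ)` satisfies
`‖φ'_x(X, ξ) - φ'_x(X, 0)‖ ≤ aξ ‖ξ‖ ‖X‖` for `‖ξ‖ ≤ r`, where `‖ξ‖² = ‖ξy‖² + ‖ξz‖²`.
For small `ξ` there is exactly one equilibrium (and it is `0` for `ξ = 0`), so that quantifying
over the equilibria `e` of `φ_x(·, ξ)` is the same as speaking of `x_eq(ξ)`. -/
def GlobalLipschitzPerturbation {n N : ℕ} (κ : Kind) (f : Fin N → Vec n → ℝ) (c : ℝ)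
    (xstar : Vec n) : Prop :=
  ∃ aξ r : ℝ, 0 < aξ ∧ 0 < r ∧
    ∀ (ξy : Vec n) (ξz : Mat n), √(‖ξy‖ ^ 2 + ‖ξz‖ ^ 2) ≤ r →
      ∀ e : Vec n, phi κ f c xstar (ones N e) ξy ξz = 0 →
        ∀ X : Stack n N,
          ‖phi κ f c xstar (X + ones N e) ξy ξz - phi κ f c xstar X 0 0‖
            ≤ aξ * √(‖ξy‖ ^ 2 + ‖ξz‖ ^ 2) * ‖X‖

/-- The memory of the agents at time `k`: `x`, `y`, `z`, and the registers `v`, `w` that hold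
`g i (x i (k - 1))` and `h i (x i (k - 1))` for `k ≥ 1`, and any initial values for `k = 0`. -/
structure State (n N : ℕ) where
  x : Fin N → Vec n
  y : Fin N → Vec n
  z : Fin N → Mat n
  v : Fin N → Vec n
  w : Fin N → Mat n

/-- One round of Newton-Raphson consensus. -/
def step {n N : ℕ} (κ : Kind) (f : Fin N → Vec n → ℝ) (c : ℝ) (P : Matrix (Fin N) (Fin N) ℝ)
    (ε : ℝ) (s : State n N) : State n N where
  x i := (1 - ε) • s.x i + ε • mv (thr c (s.z i))⁻¹ (s.y i)
  y i := ∑ j, P i j • (s.y j + gLoc κ (f j) (s.x j) - s.v j)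
  z i := ∑ j, P i j • (s.z j + hLoc κ (f j) (s.x j) - s.w j)
  v i := gLoc κ (f i) (s.x i)
  w i := hLoc κ (f i) (s.x i)

/-- The state after `k` rounds started from `s`. -/
def run {n N : ℕ} (κ : Kind) (f : Fin N → Vec n → ℝ) (c : ℝ) (P : Matrix (Fin N) (Fin N) ℝ)
    (ε : ℝ) (s : State n N) (k : ℕ) : State n N :=
  (step κ f c P ε)^[k] s

/-- The initialization error `ξ^y`, the average of `y i - v i`. -/
def State.xiY {n N : ℕ} (s : State n N) : Vec n := (1 / (N : ℝ)) • ∑ i, (s.y i - s.v i)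

/-- The initialization error `ξ^z`, the average of `z i - w i`. -/
def State.xiZ {n N : ℕ} (s : State n N) : Mat n := (1 / (N : ℝ)) • ∑ i, (s.z i - s.w i)

end

end NRC

namespace NRC

/-! Since `P` is doubly stochastic, the averages of `y - v` and `z - w` never change. So after every
round the mean of the `y i` is `ξy + gBar` and the mean of the `z i` is `ξz + hBar`, both at the
previous estimates. Up to disagreement among the messages, every agent takes an `ε`-step towards one
common target `(ξz + hBar)⁻¹ (ξy + gBar)`.

For `ξ = 0` and equal estimates `x`, this target is `x - hBar⁻¹ ∇F(x)` with `F` the average cost: a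
Newton-like descent step, for which the square root of the optimality gap is a Lyapunov function
(`sqrt_gap_step`). For small `ξ`, the limit `p` solves `∇F(p) + ξz p = ξy`. The inverse function
theorem and strong monotonicity give `p` as a `C¹` function of `ξ` (`exists_equilibrium`), and a
cutoff extends it to all `ξ`. By Assumption 3 the perturbed field recentred at `p` differs from the
unperturbed one recentred at the minimizer by a small multiple of the distance to equilibrium
(`perturbed_step_bound`), so the same Lyapunov function still decreases.

The errors are the one-step delay, the disagreement of the estimates and the disagreement of the
messages. The last is contracted by `P - J`, where `J` is the averaging matrix, at a rate
independent of `ε` (`exists_adapted_norm`), and is driven only by increments of `x`, which are of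
order `ε`. The resulting four scalar inequalities close for small `ε` (`exists_small_gain`,
`exists_tracking`). -/

/-- A linear small-gain theorem for the interconnection of a slow exponentially stable system
`(u, t)`, its increments `D`, and a fast contraction `Q`. -/
lemma exists_small_gain {a K ρ : ℝ} (ha : 0 < a) (hK : 0 < K) (hρ0 : 0 ≤ ρ) (hρ : ρ < 1) :
    ∃ εbar : ℝ, 0 < εbar ∧ ∀ ε ∈ Set.Ioo 0 εbar, ∃ γ ∈ Set.Ioo (0 : ℝ) 1,
      ∀ u t D Q : ℕ → ℝ, (∀ k, 0 ≤ u k) → (∀ k, 0 ≤ t k) → (∀ k, 0 ≤ D k) → (∀ k, 0 ≤ Q k) →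
        (∀ k, u (k + 1) ≤ (1 - 2 * a * ε) * u k + ε * K * (t k + D k + Q k)) →
        (∀ k, t (k + 1) ≤ (1 - 2 * a * ε) * t k + ε * K * Q k) →
        (∀ k, D (k + 1) ≤ ε * K * (u k + t k + D k + Q k)) →
        (∀ k, Q (k + 1) ≤ ρ * (Q k + K * D k)) →
        ∃ C : ℝ, ∀ k, u k + t k ≤ C * γ ^ k := by
  -- Weights of the Lyapunov function `u + β t + l D + μ Q`. Since `l K = a`, feedback through `D`
  -- costs half of the decay `2aε`; `β a = K + a` pays for the action of `t` on `u` and `D`; `μ K =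
  -- l / 4` makes the action of `D` on `Q` small against `l`. The bounds on `ε` below then close the
  -- columns of `D` and `Q`.
  set l : ℝ := a / K with hl
  set β : ℝ := (K + a) / a with hβ
  set μ : ℝ := l / (4 * K) with hμ
  have hl0 : 0 < l := by positivity
  have hβ0 : 0 < β := by positivity
  have hβ1 : 1 ≤ β := by rw [hβ, le_div_iff₀ ha]; linarith
  have hμ0 : 0 < μ := by positivity
  have hlK : l * K = a := by rw [hl]; field_simp
  have hβa : β * a = K + a := by rw [hβ]; field_simp
  have hμK : μ * K = l / 4 := by rw [hμ]; field_simp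
  have hρ' : 0 < 1 - ρ := by linarith
  refine ⟨min (min (l / (4 * (K + a))) (1 / (2 * a)))
    (min (μ * (1 - ρ) / (2 * (K + β * K + a))) ((1 - ρ) / (2 * a))), by positivity, ?_⟩
  rintro ε ⟨hε, hε'⟩
  simp only [lt_min_iff] at hε'
  obtain ⟨⟨h1, h2⟩, h3, h4⟩ := hε'
  rw [lt_div_iff₀ (by positivity)] at h1 h2 h3 h4
  refine ⟨1 - a * ε, ⟨by nlinarith, by nlinarith⟩, ?_⟩
  intro u t D Q hu ht hD hQ eu et eD eQ
  set S : ℕ → ℝ := fun k => u k + β * t k + l * D k + μ * Q k with hS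
  have key : ∀ k, S (k + 1) ≤ (1 - a * ε) * S k := by
    intro k
    have e1 := eu k
    have e2 := mul_le_mul_of_nonneg_left (et k) hβ0.le
    have e3 := mul_le_mul_of_nonneg_left (eD k) hl0.le
    have e4 := mul_le_mul_of_nonneg_left (eQ k) hμ0.le
    have c1 : 1 - 2 * a * ε + l * (ε * K) ≤ 1 - a * ε := by
      have : l * (ε * K) = a * ε := by rw [← hlK]; ring
      linarith
    have c2 : ε * K + β * (1 - 2 * a * ε) + l * (ε * K) ≤ (1 - a * ε) * β := by
      have h5 : l * (ε * K) = a * ε := by rw [← hlK]; ring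
      have h6 : β * a * ε = (K + a) * ε := by rw [hβa]
      nlinarith
    have c3 : ε * K + l * (ε * K) + μ * (ρ * K) ≤ (1 - a * ε) * l := by
      have h5 : l * (ε * K) = a * ε := by rw [← hlK]; ring
      have h6 : μ * (ρ * K) = ρ * (l / 4) := by rw [← hμK]; ring
      have h7 : ρ * (l / 4) ≤ l / 4 := by nlinarith
      have h8 : a * ε * l ≤ l / 2 := by nlinarith
      nlinarith
    have c4 : ε * K + β * (ε * K) + l * (ε * K) + μ * ρ ≤ (1 - a * ε) * μ := by
      have h5 : l * (ε * K) = a * ε := by rw [← hlK]; ring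
      have h8 : a * ε * μ ≤ (1 - ρ) / 2 * μ := by
        apply mul_le_mul_of_nonneg_right _ hμ0.le; linarith
      nlinarith
    have := mul_le_mul_of_nonneg_right c1 (hu k)
    have := mul_le_mul_of_nonneg_right c2 (ht k)
    have := mul_le_mul_of_nonneg_right c3 (hD k)
    have := mul_le_mul_of_nonneg_right c4 (hQ k)
    simp only [hS]
    linarith
  have hpos : 0 ≤ 1 - a * ε := by nlinarith
  refine ⟨S 0, fun k => ?_⟩
  have h5 : S k ≤ S 0 * (1 - a * ε) ^ k := by
    induction k with
    | zero => simp
    | succ k ih =>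
      calc S (k + 1) ≤ (1 - a * ε) * S k := key k
        _ ≤ (1 - a * ε) * (S 0 * (1 - a * ε) ^ k) := by gcongr
        _ = _ := by ring
  refine le_trans ?_ h5
  have := mul_nonneg hl0.le (hD k)
  have := mul_nonneg hμ0.le (hQ k)
  have := mul_le_mul_of_nonneg_right hβ1 (ht k)
  simp only [hS]
  linarith

/-! ### Averaging matrices and contraction of the disagreement. -/

section Consensus

variable {N : ℕ} {F : Type*} [NormedAddCommGroup F] [NormedSpace ℝ F]

/-- A matrix acting on families of vectors. -/
def act (A : Matrix (Fin N) (Fin N) ℝ) (u : Fin N → F) : Fin N → F := fun i => ∑ j, A i j • u j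

lemma act_add (A : Matrix (Fin N) (Fin N) ℝ) (u w : Fin N → F) :
    act A (u + w) = act A u + act A w := by
  ext i; simp [act, Finset.sum_add_distrib]

lemma act_one (u : Fin N → F) : act (1 : Matrix (Fin N) (Fin N) ℝ) u = u := by
  ext i; simp [act, Matrix.one_apply]

lemma act_mul (A B : Matrix (Fin N) (Fin N) ℝ) (u : Fin N → F) :
    act (A * B) u = act A (act B u) := by
  ext i
  simp only [act, Matrix.mul_apply, Finset.sum_smul, Finset.smul_sum, mul_smul]
  rw [Finset.sum_comm]

lemma norm_act_le (A : Matrix (Fin N) (Fin N) ℝ) (u : Fin N → F) :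
    ‖act A u‖ ≤ (∑ i, ∑ j, |A i j|) * ‖u‖ := by
  rw [pi_norm_le_iff_of_nonneg (by positivity)]
  intro i
  calc ‖∑ j, A i j • u j‖ ≤ ∑ j, |A i j| * ‖u‖ := by
        refine (norm_sum_le _ _).trans (Finset.sum_le_sum fun j _ => ?_)
        rw [norm_smul, Real.norm_eq_abs]
        gcongr
        exact norm_le_pi_norm u j
    _ = (∑ j, |A i j|) * ‖u‖ := by rw [Finset.sum_mul]
    _ ≤ _ := by
        refine mul_le_mul_of_nonneg_right ?_ (norm_nonneg _)
        exact Finset.single_le_sum (f := fun i => ∑ j, |A i j|)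
          (fun i _ => Finset.sum_nonneg fun j _ => abs_nonneg _) (Finset.mem_univ i)

/-- A matrix whose powers tend to zero contracts a norm equivalent to the sup norm. -/
lemma exists_adapted_norm {A : Matrix (Fin N) (Fin N) ℝ}
    (hA : Tendsto (fun k : ℕ => A ^ k) atTop (𝓝 0)) (F : Type*) [NormedAddCommGroup F]
    [NormedSpace ℝ F] :
    ∃ (V : (Fin N → F) → ℝ) (K ρ : ℝ), 0 < K ∧ 0 ≤ ρ ∧ ρ < 1 ∧ (∀ u, ‖u‖ ≤ V u) ∧
      (∀ u, V u ≤ K * ‖u‖) ∧ (∀ u w, V (u + w) ≤ V u + V w) ∧ ∀ u, V (act A u) ≤ ρ * V u := by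
  have h1 : Tendsto (fun k : ℕ => ∑ i, ∑ j, |(A ^ k) i j|) atTop (𝓝 0) := by
    have : (0 : ℝ) = ∑ i : Fin N, ∑ j : Fin N, |(0 : Matrix (Fin N) (Fin N) ℝ) i j| := by simp
    rw [this]
    refine tendsto_finsetSum _ fun i _ => tendsto_finsetSum _ fun j _ => ?_
    exact (((continuous_apply_apply i j).tendsto _).comp hA).abs
  -- `A ^ m` halves the norm; `m ≥ 1` keeps the term `k = 0` in the sum `V`, whence `‖u‖ ≤ V u`.
  obtain ⟨m, hm, hm0⟩ := ((h1.eventually_le_const (show (0 : ℝ) < 1 / 2 by norm_num)).and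
    (eventually_ge_atTop 1)).exists
  set V : (Fin N → F) → ℝ := fun u => ∑ k ∈ Finset.range m, ‖act (A ^ k) u‖ with hV
  set K : ℝ := 1 + ∑ k ∈ Finset.range m, ∑ i, ∑ j, |(A ^ k) i j| with hK
  have hS : 0 ≤ ∑ k ∈ Finset.range m, ∑ i, ∑ j, |(A ^ k) i j| :=
    Finset.sum_nonneg fun _ _ => Finset.sum_nonneg fun _ _ => Finset.sum_nonneg fun _ _ =>
      abs_nonneg _
  have hK1 : 1 ≤ K := by linarith
  have hK0 : 0 < K := by linarith
  have hVK : ∀ u, V u ≤ K * ‖u‖ := fun u => by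
    calc V u ≤ ∑ k ∈ Finset.range m, (∑ i, ∑ j, |(A ^ k) i j|) * ‖u‖ :=
          Finset.sum_le_sum fun k _ => norm_act_le _ _
      _ = (∑ k ∈ Finset.range m, ∑ i, ∑ j, |(A ^ k) i j|) * ‖u‖ := by rw [Finset.sum_mul]
      _ ≤ K * ‖u‖ := by gcongr; linarith
  refine ⟨V, K, 1 - 1 / (2 * K), hK0, ?_, ?_, ?_, hVK, ?_, ?_⟩
  · rw [sub_nonneg, div_le_one (by positivity)]; linarith
  · have : 0 < 1 / (2 * K) := by positivity
    linarith
  · intro u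
    calc ‖u‖ = ‖act (A ^ 0) u‖ := by rw [pow_zero, act_one]
      _ ≤ V u := Finset.single_le_sum (f := fun k => ‖act (A ^ k) u‖)
          (fun k _ => norm_nonneg _) (Finset.mem_range.2 hm0)
  · intro u w
    simp only [hV, ← Finset.sum_add_distrib, act_add]
    exact Finset.sum_le_sum fun k _ => norm_add_le _ _
  · intro u
    -- Telescoping: `V` loses at least `‖u‖ / 2` under `A`, which is at least the fraction `1 /
    -- (2K)` of `V u`.
    have h2 : V (act A u) + ‖u‖ = V u + ‖act (A ^ m) u‖ := by
      have h3 : V (act A u) = ∑ k ∈ Finset.range m, ‖act (A ^ (k + 1)) u‖ := by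
        simp only [hV, ← act_mul, pow_succ]
      rw [h3]
      have := Finset.sum_range_succ (fun k => ‖act (A ^ k) u‖) m
      rw [Finset.sum_range_succ'] at this
      simpa [act_one] using this
    have h4 : ‖act (A ^ m) u‖ ≤ 1 / 2 * ‖u‖ :=
      (norm_act_le _ _).trans (by gcongr)
    have h5 : 1 / (2 * K) * V u ≤ 1 / 2 * ‖u‖ := by
      calc 1 / (2 * K) * V u ≤ 1 / (2 * K) * (K * ‖u‖) := by gcongr; exact hVK u
        _ = _ := by field_simp
    linarith

/-- The deviation of a family of vectors from its average. -/
noncomputable def dev (u : Fin N → F) : Fin N → F := fun i => u i - (1 / (N : ℝ)) • ∑ j, u j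

/-- The averaging matrix. -/
noncomputable def avgMat (N : ℕ) : Matrix (Fin N) (Fin N) ℝ := Matrix.of fun _ _ => (1 : ℝ) / N

variable {G : SimpleGraph (Fin N)} {P : Matrix (Fin N) (Fin N) ℝ}

lemma IsAverageConsensus.pos (hP : IsAverageConsensus G P) : 0 < N := by
  have := hP.connected.nonempty
  exact Fin.pos_iff_nonempty.2 this

lemma IsAverageConsensus.col_sum (hP : IsAverageConsensus G P) (j : Fin N) : ∑ i, P i j = 1 := by
  rw [← hP.row_sum j]
  exact Finset.sum_congr rfl fun i _ => hP.symm.apply j i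

lemma IsAverageConsensus.mul_avgMat (hP : IsAverageConsensus G P) :
    P * avgMat N = avgMat N := by
  ext i j
  simp [avgMat, Matrix.mul_apply, ← Finset.sum_mul, hP.row_sum]

lemma IsAverageConsensus.avgMat_mul (hP : IsAverageConsensus G P) :
    avgMat N * P = avgMat N := by
  ext i j
  simp [avgMat, Matrix.mul_apply, ← Finset.mul_sum, hP.col_sum]

lemma avgMat_mul_self (hN : 0 < N) : avgMat N * avgMat N = avgMat N := by
  have : (N : ℝ) ≠ 0 := by positivity
  ext i j
  simp [avgMat, Matrix.mul_apply]
  field_simp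

/-- The averaging matrix `J` is idempotent and absorbs `P` on both sides, so all cross terms
collapse to `J`. The exponent must be positive: at `0` the left side is `1`. -/
lemma IsAverageConsensus.sub_pow (hP : IsAverageConsensus G P) (k : ℕ) :
    (P - avgMat N) ^ (k + 1) = P ^ (k + 1) - avgMat N := by
  induction k with
  | zero => simp
  | succ k ih =>
    have h : P ^ (k + 1) * avgMat N = avgMat N := by
      clear ih
      induction k with
      | zero => simpa using hP.mul_avgMat
      | succ k ih => rw [pow_succ, mul_assoc, hP.mul_avgMat, ih]
    rw [pow_succ, ih, sub_mul, mul_sub, mul_sub, h, hP.avgMat_mul, avgMat_mul_self hP.pos,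
      ← pow_succ]
    abel

lemma IsAverageConsensus.tendsto_sub_pow (hP : IsAverageConsensus G P) :
    Tendsto (fun k : ℕ => (P - avgMat N) ^ k) atTop (𝓝 0) := by
  rw [← tendsto_add_atTop_iff_nat 1]
  simp only [hP.sub_pow]
  have := ((tendsto_add_atTop_iff_nat 1).2 hP.tendsto_pow).sub_const (avgMat N)
  simpa [avgMat] using this

/-- With `J` the averaging matrix, `(1 - J) P = P - J = (P - J)(1 - J)`. Projecting only `u` and
leaving `w` raw turns this into a recursion for the deviation with input `w`. -/
lemma IsAverageConsensus.dev_act (hP : IsAverageConsensus G P) (u w : Fin N → F) :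
    dev (act P (u + w)) = act (P - avgMat N) (dev u + w) := by
  have hJ : ∀ u : Fin N → F, act (avgMat N) u = fun _ => (1 / (N : ℝ)) • ∑ j, u j := fun u => by
    ext i; simp [act, avgMat, Finset.smul_sum]
  have hd : ∀ u : Fin N → F, dev u = act (1 - avgMat N) u := fun u => by
    ext i
    simp [act, sub_smul, Finset.sum_sub_distrib, dev, avgMat, Finset.smul_sum, Matrix.one_apply]
  rw [hd, hd, act_add (P - avgMat N), ← act_mul, ← act_mul, sub_mul, one_mul, hP.avgMat_mul,
    act_add]
  congr 2
  rw [mul_sub, mul_one, sub_mul, hP.mul_avgMat, avgMat_mul_self hP.pos, sub_self, sub_zero]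

lemma IsAverageConsensus.sum_act (hP : IsAverageConsensus G P) (u : Fin N → F) :
    ∑ i, act P u i = ∑ i, u i := by
  simp only [act]
  rw [Finset.sum_comm]
  simp [← Finset.sum_smul, hP.col_sum]

end Consensus

/-! ### Coercive matrices, their inverses and the thresholding. -/

section Matrices

variable {n : ℕ}

lemma mv_apply (A : Mat n) (x : Vec n) (i : Fin n) : mv A x i = ∑ j, A i j * x j := by
  simp [mv, Matrix.toLpLin_apply, Matrix.mulVec, dotProduct]

lemma mv_add (A : Mat n) (x y : Vec n) : mv A (x + y) = mv A x + mv A y := by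
  simp [mv]

lemma mv_sub (A : Mat n) (x y : Vec n) : mv A (x - y) = mv A x - mv A y := by
  simp [mv]

lemma add_mv (A B : Mat n) (x : Vec n) : mv (A + B) x = mv A x + mv B x := by
  simp [mv]

lemma sub_mv (A B : Mat n) (x : Vec n) : mv (A - B) x = mv A x - mv B x := by
  simp [mv]

lemma smul_mv (a : ℝ) (A : Mat n) (x : Vec n) : mv (a • A) x = a • mv A x := by
  simp [mv]

lemma sum_mv {ι : Type*} (s : Finset ι) (A : ι → Mat n) (x : Vec n) :
    mv (∑ i ∈ s, A i) x = ∑ i ∈ s, mv (A i) x := by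
  simp [mv]

lemma one_mv (x : Vec n) : mv (1 : Mat n) x = x := by
  ext i; simp [mv_apply, Matrix.one_apply]

lemma mul_mv (A B : Mat n) (x : Vec n) : mv (A * B) x = mv A (mv B x) := by
  ext i
  simp only [mv_apply, Matrix.mul_apply, Finset.sum_mul, Finset.mul_sum, mul_assoc]
  rw [Finset.sum_comm]

lemma norm_mv_le (A : Mat n) (x : Vec n) : ‖mv A x‖ ≤ ‖A‖ * ‖x‖ := by
  have h1 : ‖A‖ ^ 2 = ∑ i, ∑ j, A i j ^ 2 := by
    rw [Matrix.frobenius_norm_def, ← Real.sqrt_eq_rpow, Real.sq_sqrt (by positivity)]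
    simp
  refine le_of_sq_le_sq ?_ (by positivity)
  rw [mul_pow, h1, EuclideanSpace.norm_sq_eq, EuclideanSpace.norm_sq_eq, Finset.sum_mul]
  refine Finset.sum_le_sum fun i _ => ?_
  rw [mv_apply, Real.norm_eq_abs, sq_abs]
  simpa using Finset.sum_mul_sq_le_sq_mul_sq Finset.univ (A i) x

lemma inner_mv (A : Mat n) (x y : Vec n) : inner ℝ x (mv A y) = x.ofLp ⬝ᵥ A.mulVec y.ofLp := by
  simp [mv, Matrix.toLpLin_apply, PiLp.inner_apply, dotProduct, mul_comm]

lemma quadLE_smul_one_iff {c : ℝ} {A : Mat n} :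
    QuadLE (c • (1 : Mat n)) A ↔ ∀ x : Vec n, c * ‖x‖ ^ 2 ≤ inner ℝ x (mv A x) := by
  have h : ∀ x : Vec n, x.ofLp ⬝ᵥ (c • (1 : Mat n)).mulVec x.ofLp = c * ‖x‖ ^ 2 := fun x => by
    rw [← inner_mv, smul_mv, one_mv, inner_smul_right, real_inner_self_eq_norm_sq]
  refine ⟨fun H x => ?_, fun H v => ?_⟩
  · rw [← h, inner_mv]; exact H _
  · have := H (WithLp.toLp 2 v)
    rwa [← h, inner_mv] at this

lemma quadLE_smul_one_iff' {m : ℝ} {A : Mat n} :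
    QuadLE A (m • (1 : Mat n)) ↔ ∀ x : Vec n, inner ℝ x (mv A x) ≤ m * ‖x‖ ^ 2 := by
  have h : ∀ x : Vec n, x.ofLp ⬝ᵥ (m • (1 : Mat n)).mulVec x.ofLp = m * ‖x‖ ^ 2 := fun x => by
    rw [← inner_mv, smul_mv, one_mv, inner_smul_right, real_inner_self_eq_norm_sq]
  refine ⟨fun H x => ?_, fun H v => ?_⟩
  · rw [← h, inner_mv]; exact H _
  · have := H (WithLp.toLp 2 v)
    rwa [← h, inner_mv] at this

variable {c : ℝ} {A : Mat n}

lemma QuadLE.norm_le_norm_mv (hA : QuadLE (c • (1 : Mat n)) A) (x : Vec n) :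
    c * ‖x‖ ≤ ‖mv A x‖ := by
  rcases (norm_nonneg x).eq_or_lt with h | h
  · simp [← h]
  · refine le_of_mul_le_mul_right ?_ h
    calc c * ‖x‖ * ‖x‖ = c * ‖x‖ ^ 2 := by ring
      _ ≤ inner ℝ x (mv A x) := quadLE_smul_one_iff.1 hA x
      _ ≤ ‖x‖ * ‖mv A x‖ := real_inner_le_norm _ _
      _ = _ := mul_comm _ _

lemma QuadLE.isUnit_det (hc : 0 < c) (hA : QuadLE (c • (1 : Mat n)) A) : IsUnit A.det := by
  rw [isUnit_iff_ne_zero]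
  intro h0
  obtain ⟨v, hv, hv0⟩ := Matrix.exists_mulVec_eq_zero_iff.2 h0
  have h1 := hA.norm_le_norm_mv (WithLp.toLp 2 v)
  have h2 : mv A (WithLp.toLp 2 v) = 0 := by
    simp [mv, Matrix.toLpLin_apply, hv0]
  rw [h2, norm_zero] at h1
  have h3 : WithLp.toLp 2 v = (0 : Vec n) := by
    rw [← norm_eq_zero]
    exact le_antisymm (by nlinarith [norm_nonneg (WithLp.toLp 2 v : Vec n)]) (norm_nonneg _)
  exact hv (by simpa using congrArg WithLp.ofLp h3)

lemma QuadLE.mv_inv_mv (hc : 0 < c) (hA : QuadLE (c • (1 : Mat n)) A) (x : Vec n) :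
    mv A⁻¹ (mv A x) = x := by
  rw [← mul_mv, Matrix.nonsing_inv_mul _ (hA.isUnit_det hc), one_mv]

lemma QuadLE.mv_mv_inv (hc : 0 < c) (hA : QuadLE (c • (1 : Mat n)) A) (x : Vec n) :
    mv A (mv A⁻¹ x) = x := by
  rw [← mul_mv, Matrix.mul_nonsing_inv _ (hA.isUnit_det hc), one_mv]

lemma QuadLE.norm_mv_inv_le (hc : 0 < c) (hA : QuadLE (c • (1 : Mat n)) A) (y : Vec n) :
    ‖mv A⁻¹ y‖ ≤ 1 / c * ‖y‖ := by
  have := hA.norm_le_norm_mv (mv A⁻¹ y)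
  rw [hA.mv_mv_inv hc] at this
  rw [one_div, inv_mul_eq_div, le_div_iff₀ hc]
  linarith

/-- Coercivity survives a small perturbation. -/
lemma QuadLE.add_of_norm_le {c' : ℝ} (hA : QuadLE (c • (1 : Mat n)) A) {B : Mat n}
    (hB : ‖B‖ ≤ c - c') : QuadLE (c' • (1 : Mat n)) (B + A) := by
  rw [quadLE_smul_one_iff] at hA ⊢
  intro x
  have h1 : |inner ℝ x (mv B x)| ≤ ‖B‖ * ‖x‖ ^ 2 := by
    refine (abs_real_inner_le_norm _ _).trans ?_
    nlinarith [norm_mv_le B x, norm_nonneg x]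
  have h2 : ‖B‖ * ‖x‖ ^ 2 ≤ (c - c') * ‖x‖ ^ 2 := by gcongr
  rw [add_mv, inner_add_right]
  linarith [hA x, (abs_le.1 h1).1]

lemma quadLE_thr (c : ℝ) (z : Mat n) : QuadLE ((c / 2) • (1 : Mat n)) (thr c z) := by
  unfold thr
  split_ifs with h
  · exact h
  · exact fun v => le_rfl

lemma thr_of_quadLE {z : Mat n} (h : QuadLE ((c / 2) • (1 : Mat n)) z) : thr c z = z :=
  if_pos h

/-- Away from its threshold the discontinuous map `[·]_c` satisfies a linear bound. -/
lemma norm_thr_sub_le (hc : 0 < c) {B : ℝ} (z : Mat n) {zb : Mat n}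
    (hzb : QuadLE ((3 * c / 4) • (1 : Mat n)) zb) (hB : ‖zb‖ ≤ B) :
    ‖thr c z - zb‖ ≤ (1 + 4 / c * (‖(c / 2) • (1 : Mat n)‖ + B)) * ‖z - zb‖ := by
  have hB0 : 0 ≤ B := (norm_nonneg _).trans hB
  by_cases h : QuadLE ((c / 2) • (1 : Mat n)) z
  · rw [thr_of_quadLE h]
    have : 0 ≤ 4 / c * (‖(c / 2) • (1 : Mat n)‖ + B) := by positivity
    nlinarith [norm_nonneg (z - zb)]
  -- The threshold can act only if `z` is farther than `c / 4` from `zb ≥ 3c/4`, so the bounded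
  -- error is at most a multiple of that distance.
  · have h1 : c / 4 < ‖z - zb‖ := by
      by_contra! h2
      refine h ?_
      have := hzb.add_of_norm_le (c' := c / 2) (B := z - zb) (by linarith)
      rwa [sub_add_cancel] at this
    rw [thr, if_neg h]
    calc ‖(c / 2) • (1 : Mat n) - zb‖ ≤ ‖(c / 2) • (1 : Mat n)‖ + B :=
          (norm_sub_le _ _).trans (by gcongr)
      _ = 4 / c * (‖(c / 2) • (1 : Mat n)‖ + B) * (c / 4) := by field_simp
      _ ≤ 4 / c * (‖(c / 2) • (1 : Mat n)‖ + B) * ‖z - zb‖ := by gcongr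
      _ ≤ _ := by nlinarith [norm_nonneg (z - zb)]

/-- The local Newton step depends in a Lipschitz way on the local copies, at the average. -/
lemma exists_norm_thr_inv_sub_le (n : ℕ) (hc : 0 < c) {B : ℝ} (hB0 : 0 ≤ B) :
    ∃ K : ℝ, 0 < K ∧ ∀ (z zb : Mat n) (y yb : Vec n), QuadLE ((3 * c / 4) • (1 : Mat n)) zb →
      ‖zb‖ ≤ B → ‖yb‖ ≤ B →
      ‖mv (thr c z)⁻¹ y - mv zb⁻¹ yb‖ ≤ K * max ‖y - yb‖ ‖z - zb‖ := by
  set L : ℝ := 1 + 4 / c * (‖(c / 2) • (1 : Mat n)‖ + B) with hL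
  have hL0 : 0 < L := by positivity
  refine ⟨1 / (c / 2) * (1 + L * (1 / (3 * c / 4) * B)), by positivity, ?_⟩
  intro z zb y yb hzb hz hy
  have hc2 : 0 < c / 2 := by positivity
  have hc3 : 0 < 3 * c / 4 := by positivity
  have ht := quadLE_thr c z
  set w := mv zb⁻¹ yb with hw
  -- Resolvent-type identity: it trades the difference of inverses for `thr c z - zb` acting on the
  -- bounded vector `w`.
  have h1 : mv (thr c z)⁻¹ y - w = mv (thr c z)⁻¹ ((y - yb) - mv (thr c z - zb) w) := by
    have h2 : mv zb w = yb := hzb.mv_mv_inv hc3 yb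
    conv_lhs => rw [← ht.mv_inv_mv hc2 w]
    rw [← mv_sub, sub_mv, h2]
    congr 1
    abel
  have h3 : ‖w‖ ≤ 1 / (3 * c / 4) * B := (hzb.norm_mv_inv_le hc3 yb).trans (by gcongr)
  have h4 := norm_thr_sub_le hc z hzb hz
  rw [← hL] at h4
  rw [h1]
  calc ‖mv (thr c z)⁻¹ ((y - yb) - mv (thr c z - zb) w)‖
      ≤ 1 / (c / 2) * ‖(y - yb) - mv (thr c z - zb) w‖ := ht.norm_mv_inv_le hc2 _
    _ ≤ 1 / (c / 2) * (‖y - yb‖ + ‖thr c z - zb‖ * ‖w‖) := by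
        gcongr
        exact (norm_sub_le _ _).trans (by gcongr; exact norm_mv_le _ _)
    _ ≤ 1 / (c / 2) * (max ‖y - yb‖ ‖z - zb‖ +
          (L * max ‖y - yb‖ ‖z - zb‖) * (1 / (3 * c / 4) * B)) := by
        have h5 : ‖thr c z - zb‖ ≤ L * max ‖y - yb‖ ‖z - zb‖ :=
          h4.trans (by gcongr; exact le_max_right _ _)
        gcongr
        exact le_max_left _ _
    _ = _ := by ring

/-- A symmetric matrix with `0 ≤ A ≤ m I` satisfies `‖A‖ ≤ n m`. -/
lemma norm_le_of_isSymm {m : ℝ} (hA : A.IsSymm) (h0 : QuadLE ((0 : ℝ) • (1 : Mat n)) A)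
    (hm0 : 0 ≤ m) (hm : QuadLE A (m • (1 : Mat n))) : ‖A‖ ≤ n * m := by
  rw [quadLE_smul_one_iff] at h0
  rw [quadLE_smul_one_iff'] at hm
  have hs : ∀ i j, |A i j| ≤ m := by
    intro i j
    set e : Fin n → Vec n := fun k => EuclideanSpace.single k 1 with he
    have hnorm : ∀ k, ‖e k‖ = 1 := fun k => by simp [he]
    have hin : ∀ k l, inner ℝ (e k) (mv A (e l)) = A k l := fun k l => by
      simp [he, EuclideanSpace.inner_single_left, mv_apply]
    -- Polarization: `4 A i j` is the difference of the forms at `e i ± e j`, each in `[0, 4m]`. The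
    -- bound `4` on the squared norms also covers `i = j`.
    have hpar := parallelogram_law_with_norm ℝ (e i) (e j)
    rw [hnorm, hnorm] at hpar
    have a1 := h0 (e i + e j)
    have a2 := hm (e i + e j)
    have a3 := h0 (e i - e j)
    have a4 := hm (e i - e j)
    simp only [mv_add, mv_sub, inner_add_left, inner_add_right, inner_sub_left, inner_sub_right,
      hin, hA.apply i j, zero_mul] at a1 a2 a3 a4
    have b1 : ‖e i + e j‖ ^ 2 ≤ 4 := by nlinarith [sq_nonneg ‖e i - e j‖]
    have b2 : ‖e i - e j‖ ^ 2 ≤ 4 := by nlinarith [sq_nonneg ‖e i + e j‖]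
    have b3 := mul_le_mul_of_nonneg_left b1 hm0
    have b4 := mul_le_mul_of_nonneg_left b2 hm0
    rw [abs_le]
    constructor <;> linarith
  refine le_of_sq_le_sq ?_ (by positivity)
  have h1 : ‖A‖ ^ 2 = ∑ i, ∑ j, A i j ^ 2 := by
    rw [Matrix.frobenius_norm_def, ← Real.sqrt_eq_rpow, Real.sq_sqrt (by positivity)]
    simp
  rw [h1]
  calc ∑ i, ∑ j, A i j ^ 2 ≤ ∑ i : Fin n, ∑ j : Fin n, m ^ 2 :=
        Finset.sum_le_sum fun i _ => Finset.sum_le_sum fun j _ => by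
          rw [← sq_abs]; exact pow_le_pow_left₀ (abs_nonneg _) (hs i j) 2
    _ = (n * m) ^ 2 := by simp; ring

end Matrices

/-! ### Descent estimates for strongly convex functions. -/

section Descent

variable {E : Type*} [NormedAddCommGroup E] [InnerProductSpace ℝ E] [CompleteSpace E]
  {F : E → ℝ} {g : E → E} {g' : E → E →L[ℝ] E} {c m : ℝ} {x₀ : E}

/-- Two integrations along the segment, phrased as monotonicity of auxiliary functions of `t`. No
sign of `c` is assumed, so that `-F` and `-m` give the upper bound. -/
lemma quadratic_lower_bound (hF : ∀ x, HasGradientAt F (g x) x)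
    (hg : ∀ x, HasFDerivAt g (g' x) x) (hc : ∀ x d, c * ‖d‖ ^ 2 ≤ inner ℝ d (g' x d)) (x d : E) :
    F x + inner ℝ (g x) d + c / 2 * ‖d‖ ^ 2 ≤ F (x + d) := by
  have hline : ∀ t : ℝ, HasDerivAt (fun t : ℝ => x + t • d) d t := fun t => by
    simpa using ((hasDerivAt_id t).smul_const d).const_add x
  have hp : ∀ t, HasDerivAt (fun t : ℝ => inner ℝ (g (x + t • d)) d - t * (c * ‖d‖ ^ 2))
      (inner ℝ (g' (x + t • d) d) d - c * ‖d‖ ^ 2) t := fun t => by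
    have h1 := ((hg (x + t • d)).comp_hasDerivAt t (hline t)).inner ℝ (hasDerivAt_const t d)
    exact (h1.fun_sub ((hasDerivAt_id t).mul_const (c * ‖d‖ ^ 2))).congr_deriv (by simp)
  have hpmono : Monotone (fun t : ℝ => inner ℝ (g (x + t • d)) d - t * (c * ‖d‖ ^ 2)) := by
    refine monotone_of_deriv_nonneg (fun t => (hp t).differentiableAt) fun t => ?_
    rw [(hp t).deriv, real_inner_comm]
    linarith [hc (x + t • d) d]
  have hq : ∀ t, HasDerivAt
      (fun t : ℝ => F (x + t • d) - t * inner ℝ (g x) d - t ^ 2 * (c / 2 * ‖d‖ ^ 2))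
      (inner ℝ (g (x + t • d)) d - inner ℝ (g x) d - 2 * t * (c / 2 * ‖d‖ ^ 2)) t := fun t => by
    have h1 := (hF (x + t • d)).hasFDerivAt.comp_hasDerivAt t (hline t)
    have h2 := (h1.fun_sub ((hasDerivAt_id t).mul_const (inner ℝ (g x) d))).fun_sub
      (((hasDerivAt_id t).fun_pow 2).mul_const (c / 2 * ‖d‖ ^ 2))
    exact h2.congr_deriv (by simp)
  have hqmono : MonotoneOn
      (fun t : ℝ => F (x + t • d) - t * inner ℝ (g x) d - t ^ 2 * (c / 2 * ‖d‖ ^ 2))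
      (Set.Icc 0 1) := by
    refine monotoneOn_of_deriv_nonneg (convex_Icc 0 1)
      (fun t _ => (hq t).continuousAt.continuousWithinAt)
      (fun t _ => (hq t).differentiableAt.differentiableWithinAt) fun t ht => ?_
    rw [interior_Icc] at ht
    rw [(hq t).deriv]
    have := hpmono ht.1.le
    simp only [zero_smul, add_zero, zero_mul, sub_zero] at this
    linarith
  have := hqmono (Set.left_mem_Icc.2 zero_le_one) (Set.right_mem_Icc.2 zero_le_one) zero_le_one
  simp only [zero_smul, add_zero, one_smul] at this
  linarith

lemma quadratic_upper_bound (hF : ∀ x, HasGradientAt F (g x) x)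
    (hg : ∀ x, HasFDerivAt g (g' x) x) (hm : ∀ x d, inner ℝ d (g' x d) ≤ m * ‖d‖ ^ 2) (x d : E) :
    F (x + d) ≤ F x + inner ℝ (g x) d + m / 2 * ‖d‖ ^ 2 := by
  have := quadratic_lower_bound (F := fun x => -F x) (g := fun x => -g x) (g' := fun x => -g' x)
    (c := -m) (fun x => by
      have := (hF x).hasFDerivAt.neg
      rw [hasGradientAt_iff_hasFDerivAt, map_neg]
      exact this) (fun x => (hg x).neg) (fun x d => by
      have := hm x d
      simp only [neg_apply, inner_neg_right]
      linarith) x d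
  simp only [inner_neg_left] at this
  linarith

lemma strongly_monotone (hF : ∀ x, HasGradientAt F (g x) x)
    (hg : ∀ x, HasFDerivAt g (g' x) x) (hc : ∀ x d, c * ‖d‖ ^ 2 ≤ inner ℝ d (g' x d)) (x y : E) :
    c * ‖x - y‖ ^ 2 ≤ inner ℝ (g x - g y) (x - y) := by
  have h1 := quadratic_lower_bound hF hg hc x (y - x)
  have h2 := quadratic_lower_bound hF hg hc y (x - y)
  rw [add_sub_cancel] at h1 h2
  rw [← neg_sub x y, inner_neg_right, norm_neg] at h1
  rw [inner_sub_left]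
  linarith

/-- The Lyapunov function of a descent method: the root of the optimality gap decreases linearly
along descent directions, and depends in a Lipschitz way on perturbations of the step. -/
lemma sqrt_gap_step (hF : ∀ x, HasGradientAt F (g x) x)
    (hg : ∀ x, HasFDerivAt g (g' x) x) (hc0 : 0 < c) (hm0 : 0 < m)
    (hc : ∀ x d, c * ‖d‖ ^ 2 ≤ inner ℝ d (g' x d))
    (hm : ∀ x d, inner ℝ d (g' x d) ≤ m * ‖d‖ ^ 2)
    (hmin : ∀ x, F x₀ ≤ F x) {b B ε : ℝ} (hε : 0 < ε) (hε1 : ε * (m * B ^ 2) ≤ b)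
    (hε2 : ε * (b * c) ≤ 2) {x d : E} (hd : inner ℝ (g x) d ≤ -b * ‖g x‖ ^ 2)
    (hd' : ‖d‖ ≤ B * ‖g x‖) (ζ : E) :
    √(F (x + ε • (d + ζ)) - F x₀) ≤
      (1 - b * c / 2 * ε) * √(F x - F x₀) + ε * (√(m / 2) * ‖ζ‖) := by
  have hup := quadratic_upper_bound hF hg hm
  have hlow := quadratic_lower_bound hF hg hc
  have hgap : ∀ x, 0 ≤ F x - F x₀ := fun x => sub_nonneg.2 (hmin x)
  -- The upper quadratic model at `x`, evaluated at its minimizer `x - g x / m`.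
  have hgrad : ∀ x, ‖g x‖ ^ 2 ≤ 2 * m * (F x - F x₀) := fun x => by
    have h1 := (hmin _).trans (hup x (-(1 / m) • g x))
    rw [inner_smul_right, real_inner_self_eq_norm_sq, norm_smul, mul_pow, Real.norm_eq_abs,
      sq_abs] at h1
    have h2 : -(1 / m) * ‖g x‖ ^ 2 + m / 2 * ((-(1 / m)) ^ 2 * ‖g x‖ ^ 2)
        = -(‖g x‖ ^ 2 / (2 * m)) := by field_simp; ring
    have h3 : ‖g x‖ ^ 2 / (2 * m) ≤ F x - F x₀ := by linarith
    rw [div_le_iff₀ (by positivity)] at h3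
    linarith
  -- Polyak–Łojasiewicz inequality, from the lower quadratic model.
  have hPL : ∀ x, 2 * c * (F x - F x₀) ≤ ‖g x‖ ^ 2 := fun x => by
    have h1 := hlow x (x₀ - x)
    rw [add_sub_cancel] at h1
    have h2 : -(‖g x‖ * ‖x₀ - x‖) ≤ inner ℝ (g x) (x₀ - x) :=
      (abs_le.1 (abs_real_inner_le_norm _ _)).1
    nlinarith [sq_nonneg (‖g x‖ - c * ‖x₀ - x‖)]
  -- By `hgrad` the upper model is bounded by a perfect square; this is why the root of the gap is
  -- used.
  have hlip : ∀ x w, √(F (x + w) - F x₀) ≤ √(F x - F x₀) + √(m / 2) * ‖w‖ := fun x w => by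
    refine Real.sqrt_le_iff.2 ⟨by positivity, ?_⟩
    have h1 := hup x w
    have h2 : inner ℝ (g x) w ≤ 2 * √(F x - F x₀) * √(m / 2) * ‖w‖ := by
      refine (real_inner_le_norm _ _).trans ?_
      gcongr
      refine abs_le_of_sq_le_sq' ?_ (by positivity) |>.2
      rw [mul_pow, mul_pow, Real.sq_sqrt (hgap x), Real.sq_sqrt (by positivity)]
      linarith [hgrad x]
    rw [add_sq, mul_pow, Real.sq_sqrt (hgap x), Real.sq_sqrt (by positivity)]
    linarith
  have h0 : 0 ≤ 1 - b * c / 2 * ε := by linarith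
  -- The curvature term uses up half of the descent; the Polyak–Łojasiewicz inequality leaves the
  -- factor `1 - bcε ≤ (1 - bcε/2)²` on the gap.
  have hdesc : √(F (x + ε • d) - F x₀) ≤ (1 - b * c / 2 * ε) * √(F x - F x₀) := by
    refine Real.sqrt_le_iff.2 ⟨by positivity, ?_⟩
    rw [mul_pow, Real.sq_sqrt (hgap x)]
    have h1 := hup x (ε • d)
    rw [inner_smul_right, norm_smul, mul_pow, Real.norm_eq_abs, sq_abs] at h1
    have h2 : ‖d‖ ^ 2 ≤ B ^ 2 * ‖g x‖ ^ 2 := by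
      rw [← mul_pow]; exact pow_le_pow_left₀ (norm_nonneg _) hd' 2
    have h3 : m / 2 * (ε ^ 2 * ‖d‖ ^ 2) ≤ ε * b / 2 * ‖g x‖ ^ 2 := by
      calc m / 2 * (ε ^ 2 * ‖d‖ ^ 2) ≤ m / 2 * (ε ^ 2 * (B ^ 2 * ‖g x‖ ^ 2)) := by gcongr
        _ = ε / 2 * ‖g x‖ ^ 2 * (ε * (m * B ^ 2)) := by ring
        _ ≤ ε / 2 * ‖g x‖ ^ 2 * b := by gcongr
        _ = _ := by ring
    have h4 : ε * inner ℝ (g x) d ≤ ε * (-b * ‖g x‖ ^ 2) := by gcongr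
    have hb : 0 ≤ b := le_trans (by positivity) hε1
    have h5 : ε * b / 2 * (2 * c * (F x - F x₀)) ≤ ε * b / 2 * ‖g x‖ ^ 2 := by
      have := hPL x
      gcongr
    have h6 : 0 ≤ (b * c / 2 * ε) ^ 2 * (F x - F x₀) := mul_nonneg (sq_nonneg _) (hgap x)
    nlinarith
  have h1 := hlip (x + ε • d) (ε • ζ)
  rw [norm_smul, Real.norm_of_nonneg hε.le, add_assoc, ← smul_add] at h1
  linarith

end Descent

/-! ### The perturbed equilibrium as a function of the initialization error. -/

section Equilibrium

variable {n : ℕ}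

/-- The matrix-vector product as a continuous bilinear map. -/
noncomputable def mvL (n : ℕ) : Mat n →L[ℝ] Vec n →L[ℝ] Vec n :=
  LinearMap.mkContinuous₂ (LinearMap.mk₂ ℝ mv add_mv smul_mv mv_add
    (fun a A x => by simp [mv])) 1 (fun A x => by rw [one_mul]; exact norm_mv_le A x)

lemma mvL_apply (A : Mat n) (x : Vec n) : mvL n A x = mv A x := rfl

/-- The zero of a strongly monotone `C¹` field, as a function of an affine perturbation of the
field, extended to all perturbations. -/
lemma exists_equilibrium {g : Vec n → Vec n} {c : ℝ} {x₀ : Vec n} (hc : 0 < c)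
    (hg : ContDiff ℝ 1 g) (hmono : ∀ x y, c * ‖x - y‖ ^ 2 ≤ inner ℝ (g x - g y) (x - y))
    (hg' : ∀ x d, c * ‖d‖ ^ 2 ≤ inner ℝ d (fderiv ℝ g x d)) (h0 : g x₀ = 0) :
    ∃ a r : ℝ, 0 < a ∧ 0 < r ∧ ∃ Ψ : Vec n × Mat n → Vec n, ContDiff ℝ 1 Ψ ∧
      (∀ (ξy : Vec n) (ξz : Mat n), ‖Ψ (ξy, ξz) - x₀‖ ≤ a * (‖ξy‖ + ‖ξz‖)) ∧
      ∀ (ξy : Vec n) (ξz : Mat n), ‖ξy‖ + ‖ξz‖ ≤ r →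
        g (Ψ (ξy, ξz)) + mv ξz (Ψ (ξy, ξz)) = ξy := by
  -- Carrying the matrix along as a second component reduces the implicit equation to a local
  -- inverse of `Φ` at `(x₀, 0)`.
  set Φ : Vec n × Mat n → Vec n × Mat n := fun q => (g q.1 + mvL n q.2 q.1, q.2) with hΦ
  have hΦs : ContDiff ℝ 1 Φ := by
    refine ContDiff.prodMk ((hg.comp contDiff_fst).add ?_) contDiff_snd
    exact ((mvL n).contDiff.comp contDiff_snd).clm_apply contDiff_fst
  have hΦ0 : Φ (x₀, 0) = 0 := by simp [hΦ, h0]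
  have hder : HasFDerivAt Φ (fderiv ℝ Φ (x₀, 0)) (x₀, 0) :=
    (hΦs.differentiable one_ne_zero _).hasFDerivAt
  have hformula : ∀ u W, fderiv ℝ Φ (x₀, 0) (u, W) = (fderiv ℝ g x₀ u + mv W x₀, W) := by
    have h1 : HasFDerivAt (fun q : Vec n × Mat n => g q.1)
        ((fderiv ℝ g x₀).comp (ContinuousLinearMap.fst ℝ _ _)) (x₀, 0) :=
      HasFDerivAt.comp (x₀, (0 : Mat n)) (hg.differentiable one_ne_zero x₀).hasFDerivAt
        hasFDerivAt_fst
    have h2 : HasFDerivAt (fun q : Vec n × Mat n => mvL n q.2)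
        ((mvL n).comp (ContinuousLinearMap.snd ℝ _ _)) (x₀, 0) :=
      HasFDerivAt.comp (x₀, (0 : Mat n)) (mvL n).hasFDerivAt hasFDerivAt_snd
    have h3 : HasFDerivAt Φ _ (x₀, 0) := (h1.add (h2.clm_apply hasFDerivAt_fst)).prodMk
      (hasFDerivAt_snd (𝕜 := ℝ) (p := (x₀, (0 : Mat n))))
    intro u W
    rw [h3.fderiv]
    change (fderiv ℝ g x₀ u + (mvL n 0 u + mvL n W x₀), W) = _
    rw [map_zero, zero_apply, zero_add, mvL_apply]
  have hinj : Function.Injective (fderiv ℝ Φ (x₀, 0)) := by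
    rw [injective_iff_map_eq_zero]
    rintro ⟨u, W⟩ h
    rw [hformula, Prod.mk_eq_zero] at h
    obtain ⟨h1, rfl⟩ := h
    have h2 : fderiv ℝ g x₀ u = 0 := by simpa [mv] using h1
    have h3 := hg' x₀ u
    rw [h2, inner_zero_right] at h3
    have h4 : ‖u‖ ^ 2 = 0 := le_antisymm (by nlinarith) (sq_nonneg _)
    simpa using h4
  set D : (Vec n × Mat n) ≃L[ℝ] (Vec n × Mat n) :=
    (LinearEquiv.ofInjectiveEndo (fderiv ℝ Φ (x₀, 0)).toLinearMap hinj).toContinuousLinearEquiv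
    with hD
  have hderD : HasFDerivAt Φ (D : (Vec n × Mat n) →L[ℝ] (Vec n × Mat n)) (x₀, 0) := by
    convert hder using 1
    exact ContinuousLinearMap.ext fun _ => rfl
  set inv := (hΦs.contDiffAt (x := (x₀, 0))).localInverse hderD one_ne_zero with hinv
  have hinvs : ContDiffAt ℝ 1 inv 0 := by
    rw [← hΦ0]
    exact (hΦs.contDiffAt (x := (x₀, 0))).to_localInverse hderD one_ne_zero
  have hstr := (hΦs.contDiffAt (x := (x₀, 0))).hasStrictFDerivAt' hderD one_ne_zero
  have hright : ∀ᶠ ξ in 𝓝 (0 : Vec n × Mat n), Φ (inv ξ) = ξ := by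
    rw [← hΦ0]
    exact hstr.eventually_right_inverse
  obtain ⟨δ, hδ, hball⟩ := Metric.eventually_nhds_iff_ball.1
    ((hinvs.eventually (by simp)).and hright)
  -- With `‖ξz‖ ≤ c / 2` the linear perturbation costs at most half of the strong monotonicity,
  -- hence the factor `2 / c` in `a`.
  set ρ : ℝ := min δ (c / 2) with hρ
  have hρ0 : 0 < ρ := by positivity
  have heq : ∀ ξ ∈ Metric.ball (0 : Vec n × Mat n) ρ,
      g (inv ξ).1 + mv ξ.2 (inv ξ).1 = ξ.1 := fun ξ hξ => by
    have h1 := (hball ξ (Metric.ball_subset_ball (min_le_left _ _) hξ)).2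
    have h2 : (inv ξ).2 = ξ.2 := show (Φ (inv ξ)).2 = ξ.2 by rw [h1]
    have h3 : (Φ (inv ξ)).1 = ξ.1 := by rw [h1]
    simp only [hΦ, h2] at h3
    exact h3
  set a : ℝ := 2 / c * (1 + ‖x₀‖) with ha
  have hbound : ∀ ξ ∈ Metric.ball (0 : Vec n × Mat n) ρ,
      ‖(inv ξ).1 - x₀‖ ≤ a * (‖ξ.1‖ + ‖ξ.2‖) := fun ξ hξ => by
    set p := (inv ξ).1 with hp
    have h1 := hmono p x₀
    have h2 : g p = ξ.1 - mv ξ.2 p := eq_sub_of_add_eq (heq ξ hξ)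
    have h3 : ‖ξ.2‖ ≤ c / 2 := by
      have : ‖ξ‖ < ρ := by simpa using hξ
      exact (norm_snd_le ξ).trans (this.le.trans (min_le_right _ _))
    have h4 : ‖mv ξ.2 p‖ ≤ ‖ξ.2‖ * ‖x₀‖ + c / 2 * ‖p - x₀‖ := by
      have : mv ξ.2 p = mv ξ.2 x₀ + mv ξ.2 (p - x₀) := by rw [← mv_add, add_sub_cancel]
      rw [this]
      refine (norm_add_le _ _).trans (add_le_add (norm_mv_le _ _) ?_)
      exact (norm_mv_le _ _).trans (by gcongr)
    rw [h0, sub_zero] at h1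
    have h5 : c * ‖p - x₀‖ ^ 2 ≤ ‖g p‖ * ‖p - x₀‖ := h1.trans (real_inner_le_norm _ _)
    have h6 : c * ‖p - x₀‖ ≤ ‖g p‖ := by
      rcases (norm_nonneg (p - x₀)).eq_or_lt with h | h
      · rw [← h]; simp
      · exact le_of_mul_le_mul_right (by linarith) h
    have h7 : ‖g p‖ ≤ ‖ξ.1‖ + (‖ξ.2‖ * ‖x₀‖ + c / 2 * ‖p - x₀‖) := by
      rw [h2]; exact (norm_sub_le _ _).trans (by gcongr)
    have h8 : c / 2 * ‖p - x₀‖ ≤ (1 + ‖x₀‖) * (‖ξ.1‖ + ‖ξ.2‖) := by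
      nlinarith [mul_nonneg (norm_nonneg x₀) (norm_nonneg ξ.1), norm_nonneg ξ.2]
    calc ‖p - x₀‖ = 2 / c * (c / 2 * ‖p - x₀‖) := by field_simp
      _ ≤ 2 / c * ((1 + ‖x₀‖) * (‖ξ.1‖ + ‖ξ.2‖)) := by gcongr
      _ = _ := by rw [ha]; ring
  -- The cutoff makes the map globally `C¹`, equal to `x₀` far out; since `0 ≤ χ ≤ 1`, the linear
  -- bound survives everywhere.
  let χ : ContDiffBump (0 : Vec n × Mat n) := ⟨ρ / 4, ρ / 2, by positivity, by linarith⟩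
  refine ⟨a, ρ / 4, by positivity, by positivity, fun ξ => x₀ + χ ξ • ((inv ξ).1 - x₀), ?_, ?_, ?_⟩
  · rw [contDiff_iff_contDiffAt]
    intro ξ
    by_cases hξ : ξ ∈ Metric.ball (0 : Vec n × Mat n) ρ
    · have h1 := (hball ξ (Metric.ball_subset_ball (min_le_left _ _) hξ)).1
      exact contDiffAt_const.add
        (χ.contDiffAt.smul ((contDiffAt_fst.comp ξ h1).sub contDiffAt_const))
    · have h1 : ρ / 2 < dist ξ 0 := by
        rw [Metric.mem_ball, not_lt] at hξ
        exact lt_of_lt_of_le (half_lt_self hρ0) hξ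
      refine (contDiffAt_const (c := x₀)).congr_of_eventuallyEq ?_
      have h2 : Tendsto (fun ζ : Vec n × Mat n => dist ζ 0) (𝓝 ξ) (𝓝 (dist ξ 0)) :=
        tendsto_id.dist tendsto_const_nhds
      filter_upwards [h2.eventually_const_lt h1] with ζ hζ
      rw [χ.zero_of_le_dist hζ.le, zero_smul, add_zero]
  · intro ξy ξz
    rw [add_sub_cancel_left, norm_smul, Real.norm_of_nonneg χ.nonneg]
    by_cases hξ : (ξy, ξz) ∈ Metric.ball (0 : Vec n × Mat n) ρ
    · calc χ (ξy, ξz) * ‖(inv (ξy, ξz)).1 - x₀‖ ≤ 1 * ‖(inv (ξy, ξz)).1 - x₀‖ := by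
            gcongr; exact χ.le_one
        _ ≤ _ := by rw [one_mul]; exact hbound _ hξ
    · have : χ (ξy, ξz) = 0 := by
        refine χ.zero_of_le_dist ?_
        rw [Metric.mem_ball, not_lt] at hξ
        exact le_trans (half_le_self hρ0.le) hξ
      rw [this, zero_mul]
      positivity
  · intro ξy ξz hξ
    have h1 : ‖(ξy, ξz)‖ ≤ ρ / 4 :=
      max_le (by linarith [norm_nonneg ξz]) (by linarith [norm_nonneg ξy])
    have h2 : χ (ξy, ξz) = 1 := χ.one_of_mem_closedBall (by simpa using h1)
    simp only [h2, one_smul, add_sub_cancel]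
    exact heq (ξy, ξz) (by rw [Metric.mem_ball, dist_zero_right]; linarith)

end Equilibrium

/-! ### Agents tracking a common, delayed descent field. -/

section Tracking

variable {N : ℕ} {E : Type*} [NormedAddCommGroup E]

lemma norm_mean_le [NormedSpace ℝ E] (hN : 0 < N) (u : Fin N → E) :
    ‖(1 / (N : ℝ)) • ∑ i, u i‖ ≤ ‖u‖ := by
  have hN' : (0 : ℝ) < N := by exact_mod_cast hN
  rw [norm_smul, Real.norm_of_nonneg (by positivity), one_div, inv_mul_le_iff₀ hN']
  simpa using norm_sum_le_of_le Finset.univ fun i _ => norm_le_pi_norm u i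

lemma norm_dev_le [NormedSpace ℝ E] (hN : 0 < N) (u : Fin N → E) : ‖dev u‖ ≤ 2 * ‖u‖ := by
  rw [pi_norm_le_iff_of_nonneg (by positivity)]
  intro i
  have := norm_sub_le (u i) ((1 / (N : ℝ)) • ∑ j, u j)
  have := norm_mean_le hN u
  have := norm_le_pi_norm u i
  simp only [dev]
  linarith

lemma mean_const [NormedSpace ℝ E] (hN : 0 < N) (x : E) :
    (1 / (N : ℝ)) • ∑ _i : Fin N, x = x := by
  have hN' : (N : ℝ) ≠ 0 := by exact_mod_cast hN.ne'
  rw [Finset.sum_const, Finset.card_univ, Fintype.card_fin, ← Nat.cast_smul_eq_nsmul ℝ, smul_smul,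
    one_div_mul_cancel hN', one_smul]

variable [InnerProductSpace ℝ E] [CompleteSpace E]
  {F : E → ℝ} {g : E → E} {g' : E → E →L[ℝ] E} {c m : ℝ} {x₀ : E}

set_option maxHeartbeats 1000000 in
/-- Convergence of agents that follow, with small step size, a common descent field `ψ` up to a
small relative error, a delay of one step, and an error that is driven by the increments through
a fast contraction. -/
lemma exists_tracking (hN : 0 < N) (hF : ∀ x, HasGradientAt F (g x) x)
    (hg : ∀ x, HasFDerivAt g (g' x) x) (hc0 : 0 < c) (hm0 : 0 < m)
    (hc : ∀ x d, c * ‖d‖ ^ 2 ≤ inner ℝ d (g' x d))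
    (hm : ∀ x d, inner ℝ d (g' x d) ≤ m * ‖d‖ ^ 2)
    (hmin : ∀ x, F x₀ ≤ F x) (hg0 : g x₀ = 0) {b B L K ρ : ℝ} (hb : 0 < b)
    (hL : 0 ≤ L) (hK : 0 ≤ K) (hρ0 : 0 ≤ ρ) (hρ : ρ < 1) {ψ : (Fin N → E) → E}
    (hψ : ∀ X X', ‖ψ X - ψ X'‖ ≤ L * ‖X - X'‖)
    (hdesc : ∀ x, inner ℝ (g x) (ψ (fun _ => x) - x) ≤ -b * ‖g x‖ ^ 2)
    (hdesc' : ∀ x, ‖ψ (fun _ => x) - x‖ ≤ B * ‖g x‖) :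
    ∃ r εbar : ℝ, 0 < r ∧ 0 < εbar ∧ ∀ ε ∈ Set.Ioo 0 εbar, ∃ γ ∈ Set.Ioo (0 : ℝ) 1,
      ∀ (p : E) (T : ℕ → E) (X η : ℕ → Fin N → E) (Q : ℕ → ℝ), (∀ k, 0 ≤ Q k) →
        (∀ k i, X (k + 2) i = (1 - ε) • X (k + 1) i + ε • (T k + η k i)) →
        (∀ k, ‖η k‖ ≤ K * Q k) →
        (∀ k, ‖(T k - p) - (ψ (fun i => X k i - p + x₀) - x₀)‖ ≤ r * ‖fun i => X k i - p‖) →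
        (∀ k, Q (k + 1) ≤ ρ * (Q k + K * ‖X (k + 1) - X k‖)) →
        ∃ C : ℝ, ∀ k, ‖fun i => X (k + 1) i - p‖ ≤ C * γ ^ k := by
  set s₁ : ℝ := √(2 / c) with hs₁
  set s₂ : ℝ := √(m / 2) with hs₂
  have hs₁0 : 0 ≤ s₁ := Real.sqrt_nonneg _
  have hs₂0 : 0 ≤ s₂ := Real.sqrt_nonneg _
  set α : ℝ := b * c / 2 with hα
  have hα0 : 0 < α := by positivity
  -- The relative error may use up at most half of the decay rate `α` of the Lyapunov function.
  set r : ℝ := min 1 (α / (2 * (s₂ * s₁ + 1))) with hr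
  have hr0 : 0 < r := by positivity
  have hr1 : r ≤ 1 := min_le_left _ _
  have hrα : s₂ * (r * s₁) ≤ α / 2 := by
    have h1 : r ≤ α / (2 * (s₂ * s₁ + 1)) := min_le_right _ _
    rw [le_div_iff₀ (by positivity)] at h1
    nlinarith [mul_nonneg hs₂0 hs₁0]
  set a : ℝ := min (α / 2) 1 / 2 with ha
  have ha0 : 0 < a := by positivity
  have haα : 2 * a ≤ α / 2 := by rw [ha]; linarith [min_le_left (α / 2) 1]
  have ha1 : 2 * a ≤ 1 := by rw [ha]; linarith [min_le_right (α / 2) 1]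
  -- One constant dominating every coupling coefficient below.
  set K' : ℝ := 1 + s₂ * (1 + L + K) + 2 * K + (2 + L) * (s₁ + 1) + K with hK'
  have hK'0 : 0 < K' := by positivity
  obtain ⟨ε₀, hε₀, hgain⟩ := exists_small_gain ha0 hK'0 hρ0 hρ
  refine ⟨r, min (min ε₀ 1) (min (b / (m * B ^ 2 + 1)) (2 / (b * c))), hr0, by positivity, ?_⟩
  rintro ε ⟨hε, hε'⟩
  simp only [lt_min_iff] at hε'
  obtain ⟨⟨hε1, hε2⟩, hε3, hε4⟩ := hε'
  rw [lt_div_iff₀ (by positivity)] at hε3 hε4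
  obtain ⟨γ, hγ, hgain⟩ := hgain ε ⟨hε, hε1⟩
  refine ⟨γ, hγ, ?_⟩
  intro p T X η Q hQ hX hη hT hQs
  set e : ℕ → Fin N → E := fun k i => X k i - p with he
  set eb : ℕ → E := fun k => (1 / (N : ℝ)) • ∑ i, e k i with heb
  set ηb : ℕ → E := fun k => (1 / (N : ℝ)) • ∑ i, η k i with hηb
  -- The gap is taken at `x₀` plus the mean error relative to `p`, because the field recentred from
  -- `p` to `x₀` is nearly the unperturbed one. `u` and `t` refer to time `k + 1`, while the target
  -- `T k` still depends on `X k`; `D k` pays for this delay.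
  set u : ℕ → ℝ := fun k => √(F (x₀ + eb (k + 1)) - F x₀) with hu
  set t : ℕ → ℝ := fun k => ‖dev (e (k + 1))‖ with ht
  set D : ℕ → ℝ := fun k => ‖X (k + 1) - X k‖ with hD
  have hu0 : ∀ k, 0 ≤ u k := fun k => Real.sqrt_nonneg _
  have ht0 : ∀ k, 0 ≤ t k := fun k => norm_nonneg _
  have hD0 : ∀ k, 0 ≤ D k := fun k => norm_nonneg _
  have hebu : ∀ k, ‖eb (k + 1)‖ ≤ s₁ * u k := fun k => by
    have h1 := quadratic_lower_bound hF hg hc x₀ (eb (k + 1))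
    rw [hg0, inner_zero_left, add_zero] at h1
    rw [hs₁, hu, ← Real.sqrt_mul (by positivity)]
    refine Real.le_sqrt_of_sq_le ?_
    calc ‖eb (k + 1)‖ ^ 2 = 2 / c * (c / 2 * ‖eb (k + 1)‖ ^ 2) := by field_simp
      _ ≤ _ := by gcongr; linarith
  have heE : ∀ k, ‖e (k + 1)‖ ≤ s₁ * u k + t k := fun k => by
    rw [pi_norm_le_iff_of_nonneg (by have := hu0 k; have := ht0 k; positivity)]
    intro i
    have h1 : e (k + 1) i = eb (k + 1) + dev (e (k + 1)) i := by simp [dev, heb]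
    rw [h1]
    exact (norm_add_le _ _).trans (add_le_add (hebu k) (norm_le_pi_norm (dev (e (k + 1))) i))
  have hePrev : ∀ k, ‖e k‖ ≤ s₁ * u k + t k + D k := fun k => by
    have h1 : e k = e (k + 1) - (X (k + 1) - X k) := by ext i; simp [he]
    rw [h1]
    exact (norm_sub_le _ _).trans (add_le_add (heE k) le_rfl)
  have hηi : ∀ k i, ‖η k i‖ ≤ K * Q k := fun k i => (norm_le_pi_norm (η k) i).trans (hη k)
  have hηb' : ∀ k, ‖ηb k‖ ≤ K * Q k := fun k => (norm_mean_le hN (η k)).trans (hη k)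
  have heX : ∀ k i, e (k + 2) i = (1 - ε) • e (k + 1) i + ε • (T k - p + η k i) := fun k i => by
    simp only [he, hX k i, smul_sub, smul_add, sub_smul, one_smul]
    abel
  have hebX : ∀ k, eb (k + 2) = (1 - ε) • eb (k + 1) + ε • (T k - p + ηb k) := fun k => by
    simp only [heb, hηb, heX]
    rw [Finset.sum_add_distrib, ← Finset.smul_sum, ← Finset.smul_sum, Finset.sum_add_distrib,
      smul_add, smul_comm _ (1 - ε), smul_comm _ ε, smul_add (1 / (N : ℝ)), mean_const hN]
  have hψ0 : ψ (fun _ => x₀) = x₀ := by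
    have := hdesc' x₀
    rw [hg0, norm_zero, mul_zero] at this
    exact sub_eq_zero.1 (norm_le_zero_iff.1 this)
  have hut : ∀ k, u (k + 1) ≤ (1 - 2 * a * ε) * u k + ε * K' * (t k + D k + Q k) := fun k => by
    set x := x₀ + eb (k + 1) with hx
    -- `ζ` is all that separates the mean step from the exact descent step at `x`: the relative
    -- error, the delay and disagreement in the argument of `ψ`, and the mean of `η`.
    set ζ : E := (T k - p + ηb k) - eb (k + 1) - (ψ (fun _ => x) - x) with hζ
    have h1 : x₀ + eb (k + 2) = x + ε • ((ψ (fun _ => x) - x) + ζ) := by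
      rw [hζ, hebX, hx, add_sub_cancel, smul_sub ε, sub_smul, one_smul]
      abel
    have h2 := sqrt_gap_step hF hg hc0 hm0 hc hm hmin (b := b) (B := B) hε
      (by nlinarith) (by linarith) (hdesc x) (hdesc' x) ζ
    rw [← h1] at h2
    have h3 : ‖ζ‖ ≤ r * ‖e k‖ + L * (D k + t k) + K * Q k := by
      have h4 : ζ = ((T k - p) - (ψ (fun i => X k i - p + x₀) - x₀)) +
          (ψ (fun i => X k i - p + x₀) - ψ (fun _ => x)) + ηb k := by
        rw [hζ, hx]; abel
      have h5 : ‖(fun i => X k i - p + x₀) - fun _ => x‖ ≤ D k + t k := by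
        have : ((fun i => X k i - p + x₀) - fun _ => x) =
            dev (e (k + 1)) - (X (k + 1) - X k) := by
          ext i
          simp only [hx, dev, heb, he, Pi.sub_apply]
          abel
        rw [this, add_comm (D k)]
        exact norm_sub_le (dev (e (k + 1))) (X (k + 1) - X k)
      rw [h4]
      refine (norm_add_le _ _).trans (add_le_add ((norm_add_le _ _).trans
        (add_le_add (hT k) ((hψ _ _).trans ?_))) (hηb' k))
      gcongr
    have h6 : s₂ * ‖ζ‖ ≤ α / 2 * u k + K' * (t k + D k + Q k) := by
      have h7 : r * ‖e k‖ ≤ r * s₁ * u k + (t k + D k) := by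
        calc r * ‖e k‖ ≤ r * (s₁ * u k + t k + D k) := by gcongr; exact hePrev k
          _ = r * s₁ * u k + r * (t k + D k) := by ring
          _ ≤ r * s₁ * u k + 1 * (t k + D k) := by
            have := ht0 k; have := hD0 k; gcongr
          _ = _ := by ring
      calc s₂ * ‖ζ‖ ≤ s₂ * (r * s₁ * u k + (t k + D k) + L * (D k + t k) + K * Q k) := by
            gcongr; linarith
        _ = s₂ * (r * s₁) * u k + s₂ * (1 + L) * (t k + D k) + s₂ * K * Q k := by ring
        _ ≤ α / 2 * u k + K' * (t k + D k) + K' * Q k := by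
            have := hu0 k; have := ht0 k; have := hD0 k; have := hQ k
            have e1 : 0 ≤ s₂ * K := by positivity
            have e2 : 0 ≤ s₂ * (1 + L) := by positivity
            have e3 : 0 ≤ (2 + L) * (s₁ + 1) := by positivity
            have e4 : K' = 1 + s₂ * (1 + L) + s₂ * K + 2 * K + (2 + L) * (s₁ + 1) + K := by
              rw [hK']; ring
            gcongr <;> linarith
        _ = _ := by ring
    calc u (k + 1) ≤ (1 - α * ε) * u k + ε * (s₂ * ‖ζ‖) := h2
      _ ≤ (1 - α * ε) * u k + ε * (α / 2 * u k + K' * (t k + D k + Q k)) := by gcongr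
      _ = (1 - α / 2 * ε) * u k + ε * K' * (t k + D k + Q k) := by ring
      _ ≤ _ := by have := hu0 k; gcongr
  have htt : ∀ k, t (k + 1) ≤ (1 - 2 * a * ε) * t k + ε * K' * Q k := fun k => by
    have h1 : dev (e (k + 2)) = (1 - ε) • dev (e (k + 1)) + ε • dev (η k) := by
      ext i
      have h2 := hebX k
      simp only [heb, hηb] at h2
      simp only [dev, Pi.add_apply, Pi.smul_apply, h2, heX k i, smul_sub, smul_add]
      abel
    have h3 := norm_dev_le hN (η k)
    have h4 : 2 * K ≤ K' := by
      have e1 : 0 ≤ s₂ * (1 + L + K) := by positivity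
      have e3 : 0 ≤ (2 + L) * (s₁ + 1) := by positivity
      linarith
    calc t (k + 1) ≤ (1 - ε) * t k + ε * ‖dev (η k)‖ := by
          simp only [ht, h1]
          refine (norm_add_le _ _).trans ?_
          rw [norm_smul, norm_smul, Real.norm_of_nonneg hε.le,
            Real.norm_of_nonneg (by linarith : 0 ≤ 1 - ε)]
      _ ≤ (1 - ε) * t k + ε * (2 * K * Q k) := by gcongr; linarith [hη k]
      _ ≤ (1 - 2 * a * ε) * t k + ε * (K' * Q k) := by
          have := ht0 k; have := hQ k
          gcongr
          nlinarith
      _ = _ := by ring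
  have hDt : ∀ k, D (k + 1) ≤ ε * K' * (u k + t k + D k + Q k) := fun k => by
    have hu := hu0 k; have ht := ht0 k; have hD' := hD0 k; have hQ' := hQ k
    simp only [hD]
    rw [pi_norm_le_iff_of_nonneg (by positivity)]
    intro i
    have h1 : (X (k + 1 + 1) - X (k + 1)) i = ε • ((T k - p) + η k i - e (k + 1) i) := by
      simp only [Pi.sub_apply, hX k i, he, smul_add, smul_sub, sub_smul, one_smul]
      abel
    have h2 : ‖T k - p‖ ≤ (r + L) * ‖e k‖ := by
      have h3 : T k - p = ((T k - p) - (ψ (fun i => X k i - p + x₀) - x₀)) +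
          (ψ (fun i => X k i - p + x₀) - ψ (fun _ => x₀)) := by rw [hψ0]; abel
      have h4 : ((fun i => X k i - p + x₀) - fun _ => x₀) = e k := by ext i; simp [he]
      have h5 := hψ (fun i => X k i - p + x₀) (fun _ => x₀)
      rw [h4] at h5
      rw [h3, add_mul]
      exact (norm_add_le _ _).trans (add_le_add (hT k) h5)
    rw [h1, norm_smul, Real.norm_of_nonneg hε.le, mul_assoc]
    gcongr
    have h6 := norm_sub_le ((T k - p) + η k i) (e (k + 1) i)
    have h7 := norm_add_le (T k - p) (η k i)
    have h8 := hηi k i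
    have h9 := (norm_le_pi_norm (e (k + 1)) i).trans (heE k)
    have h10 : (r + L) * ‖e k‖ ≤ (1 + L) * (s₁ * u k + t k + D k) := by
      gcongr; exact hePrev k
    calc ‖(T k - p) + η k i - e (k + 1) i‖
        ≤ (1 + L) * (s₁ * u k + t k + D k) + K * Q k + (s₁ * u k + t k) := by linarith
      _ = ((2 + L) * s₁) * u k + (2 + L) * t k + (1 + L) * D k + K * Q k := by ring
      _ ≤ K' * u k + K' * t k + K' * D k + K' * Q k := by
          have e1 : 0 ≤ s₂ * (1 + L + K) := by positivity
          have e2 : 0 ≤ (2 + L) * s₁ := by positivity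
          have e3 : (2 + L) * (s₁ + 1) = (2 + L) * s₁ + (2 + L) := by ring
          gcongr <;> linarith
      _ = _ := by ring
  have hQt : ∀ k, Q (k + 1) ≤ ρ * (Q k + K' * D k) := fun k => by
    have hD' := hD0 k
    refine (hQs k).trans ?_
    have h4 : K ≤ K' := by
      have e1 : 0 ≤ s₂ * (1 + L + K) := by positivity
      have e3 : 0 ≤ (2 + L) * (s₁ + 1) := by positivity
      linarith
    gcongr
  obtain ⟨C, hC⟩ := hgain u t D Q hu0 ht0 hD0 hQ hut htt hDt hQt
  refine ⟨(s₁ + 1) * C, fun k => ?_⟩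
  calc ‖e (k + 1)‖ ≤ s₁ * u k + t k := heE k
    _ ≤ (s₁ + 1) * (u k + t k) := by nlinarith [mul_nonneg hs₁0 (ht0 k), hu0 k]
    _ ≤ (s₁ + 1) * (C * γ ^ k) := by gcongr; exact hC k
    _ = _ := by ring

end Tracking

/-! ### Gradients, Hessians and translation of the costs. -/

section Calculus

variable {n N : ℕ}

lemma gradient_apply (f : Vec n → ℝ) (x : Vec n) (i : Fin n) :
    gradient f x i = fderiv ℝ f x (EuclideanSpace.single i 1) := by
  have h : inner ℝ (gradient f x) (EuclideanSpace.single i (1 : ℝ)) =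
      fderiv ℝ f x (EuclideanSpace.single i 1) := by
    rw [gradient, InnerProductSpace.toDual_symm_apply]
  rw [← h, EuclideanSpace.inner_single_right]
  simp

lemma contDiff_gradient {f : Vec n → ℝ} (hf : ContDiff ℝ 3 f) : ContDiff ℝ 2 (gradient f) := by
  rw [contDiff_euclidean]
  intro i
  simp only [gradient_apply]
  exact (hf.fderiv_right (m := 2) (by norm_num)).clm_apply contDiff_const

lemma hessian_isSymm {f : Vec n → ℝ} (hf : ContDiff ℝ 3 f) (x : Vec n) :
    (hessian f x).IsSymm := by
  have hg : Differentiable ℝ (gradient f) := (contDiff_gradient hf).differentiable two_ne_zero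
  have hd : Differentiable ℝ (fderiv ℝ f) :=
    (hf.fderiv_right (m := 2) (by norm_num)).differentiable two_ne_zero
  have h : ∀ i j, hessian f x i j =
      fderiv ℝ (fderiv ℝ f) x (EuclideanSpace.single j 1) (EuclideanSpace.single i 1) := by
    intro i j
    have h1 : HasFDerivAt (fun x => gradient f x i)
        ((EuclideanSpace.proj i).comp (fderiv ℝ (gradient f) x)) x :=
      (EuclideanSpace.proj i : Vec n →L[ℝ] ℝ).hasFDerivAt.comp x (hg x).hasFDerivAt
    have h2 : HasFDerivAt (fun x => gradient f x i)
        ((fderiv ℝ (fderiv ℝ f) x).flip (EuclideanSpace.single i 1)) x := by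
      simp only [gradient_apply]
      simpa using (hd x).hasFDerivAt.clm_apply (hasFDerivAt_const (EuclideanSpace.single i 1) x)
    exact congrArg (fun l : Vec n →L[ℝ] ℝ => l (EuclideanSpace.single j 1)) (h1.unique h2)
  refine Matrix.IsSymm.ext fun i j => ?_
  rw [h, h]
  exact (hf.contDiffAt.isSymmSndFDerivAt (by simp; norm_num)) _ _

lemma mv_hessian (f : Vec n → ℝ) (x v : Vec n) :
    mv (hessian f x) v = fderiv ℝ (gradient f) x v := by
  have hv : v = ∑ j, v j • EuclideanSpace.single j (1 : ℝ) := by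
    ext i; simp [Pi.single_apply]
  ext i
  conv_rhs => rw [hv, map_sum]
  simp [mv_apply, hessian, mul_comm]

lemma gradient_translate (f : Vec n → ℝ) (a : Vec n) :
    gradient (fun x => f (x + a)) = fun x => gradient f (x + a) := by
  ext x : 1
  simp [gradient, fderiv_comp_add_right]

lemma hLoc_translate (κ : Kind) (f : Vec n → ℝ) (a x : Vec n) :
    hLoc κ (fun x => f (x + a)) x = hLoc κ f (x + a) := by
  have h : hessian (fun x => f (x + a)) x = hessian f (x + a) := by
    simp [hessian, gradient_translate, fderiv_comp_add_right]
  cases κ <;> simp [hLoc, h]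

lemma gLoc_translate (κ : Kind) (f : Vec n → ℝ) (a x : Vec n) :
    gLoc κ (fun x => f (x + a)) x = gLoc κ f (x + a) - mv (hLoc κ f (x + a)) a := by
  simp only [gLoc, hLoc_translate, gradient_translate, mv_add]
  abel

lemma hLoc_shiftCost (κ : Kind) (f : Fin N → Vec n → ℝ) (a : Vec n) (i : Fin N) (x : Vec n) :
    hLoc κ (shiftCost f a i) x = hLoc κ (f i) (x + a) :=
  hLoc_translate κ (f i) a x

lemma gLoc_shiftCost (κ : Kind) (f : Fin N → Vec n → ℝ) (a : Vec n) (i : Fin N) (x : Vec n) :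
    gLoc κ (shiftCost f a i) x = gLoc κ (f i) (x + a) - mv (hLoc κ (f i) (x + a)) a :=
  gLoc_translate κ (f i) a x

lemma hBar_shiftCost (κ : Kind) (f : Fin N → Vec n → ℝ) (a : Vec n) (X : Stack n N) :
    hBar κ (shiftCost f a) X = hBar κ f (X + ones N a) := by
  simp only [hBar, hLoc_shiftCost]
  rfl

lemma gBar_shiftCost (κ : Kind) (f : Fin N → Vec n → ℝ) (a : Vec n) (X : Stack n N) :
    gBar κ (shiftCost f a) X =
      gBar κ f (X + ones N a) - mv (hBar κ f (X + ones N a)) a := by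
  simp only [gBar, hBar, gLoc_shiftCost, Finset.sum_sub_distrib, smul_sub, smul_mv,
    sum_mv]
  rfl

/-- The summand `hBar xstar` in `phi` cancels the term that translation subtracts from `g`, leaving
the field of the algorithm in its own coordinates. -/
lemma phi_shiftCost_apply (κ : Kind) (f : Fin N → Vec n → ℝ) (c : ℝ) (a : Vec n) (X : Stack n N)
    (ξy : Vec n) (ξz : Mat n) (i : Fin N) :
    phi κ (shiftCost f a) c a X ξy ξz i = - X i - a +
      mv (thr c (ξz + hBar κ f (X + ones N a)))⁻¹ (ξy + gBar κ f (X + ones N a)) := by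
  simp only [phi, hBar_shiftCost, gBar_shiftCost, sub_add_cancel]

lemma psi_shiftCost (κ : Kind) (f : Fin N → Vec n → ℝ) {c : ℝ} (hc : 0 < c) (a : Vec n)
    {X : Stack n N} (hX : QuadLE (c • (1 : Mat n)) (hBar κ f (X + ones N a))) :
    psi κ (shiftCost f a) X = psi κ f (X + ones N a) - a := by
  simp only [psi, hBar_shiftCost, gBar_shiftCost, mv_sub]
  rw [hX.mv_inv_mv hc]

lemma hLoc_isSymm (κ : Kind) {f : Vec n → ℝ} (hf : ContDiff ℝ 3 f) (x : Vec n) :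
    (hLoc κ f x).IsSymm := by
  cases κ
  · exact hessian_isSymm hf x
  · exact Matrix.isSymm_diagonal _
  · exact Matrix.isSymm_one

lemma hBar_isSymm (κ : Kind) {f : Fin N → Vec n → ℝ} (hf : ∀ i, ContDiff ℝ 3 (f i))
    (X : Stack n N) : (hBar κ f X).IsSymm := by
  unfold hBar
  refine Matrix.IsSymm.smul ?_ _
  rw [Matrix.IsSymm, Matrix.transpose_sum]
  exact Finset.sum_congr rfl fun i _ => hLoc_isSymm κ (hf i) _

lemma contDiff_avgCost {f : Fin N → Vec n → ℝ} (hf : ∀ i, ContDiff ℝ 3 (f i)) :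
    ContDiff ℝ 3 (avgCost f) :=
  contDiff_const.mul (ContDiff.sum fun i _ => hf i)

lemma gradient_avgCost {f : Fin N → Vec n → ℝ} (hf : ∀ i, ContDiff ℝ 3 (f i)) (x : Vec n) :
    gradient (avgCost f) x = (1 / (N : ℝ)) • ∑ i, gradient (f i) x := by
  have hd : ∀ i, DifferentiableAt ℝ (f i) x := fun i => (hf i).differentiable three_ne_zero x
  have h : fderiv ℝ (avgCost f) x = (1 / (N : ℝ)) • ∑ i, fderiv ℝ (f i) x :=
    ((HasFDerivAt.fun_sum fun i _ => (hd i).hasFDerivAt).const_mul (1 / (N : ℝ))).fderiv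
  ext j
  simp [gradient_apply, h]

lemma gBar_ones (κ : Kind) {f : Fin N → Vec n → ℝ} (hf : ∀ i, ContDiff ℝ 3 (f i)) (x : Vec n) :
    gBar κ f (ones N x) = mv (hBar κ f (ones N x)) x - gradient (avgCost f) x := by
  simp only [gBar, hBar, gLoc, Finset.sum_sub_distrib, smul_sub, smul_mv, sum_mv,
    gradient_avgCost hf]
  rfl

lemma norm_stack_le (u : Fin N → Vec n) : ‖(WithLp.toLp 2 u : Stack n N)‖ ≤ √N * ‖u‖ := by
  rw [PiLp.norm_eq_of_L2]
  refine Real.sqrt_le_iff.2 ⟨by positivity, ?_⟩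
  rw [mul_pow, Real.sq_sqrt (by positivity)]
  calc ∑ i, ‖u i‖ ^ 2 ≤ ∑ _i : Fin N, ‖u‖ ^ 2 := by
        gcongr with i; exact norm_le_pi_norm u i
    _ = _ := by simp

end Calculus

/-! ### Conserved averages and the dynamics of the messages. -/

section Algorithm

variable {n N : ℕ} {G : SimpleGraph (Fin N)} {P : Matrix (Fin N) (Fin N) ℝ}

lemma run_succ (κ : Kind) (f : Fin N → Vec n → ℝ) (c : ℝ) (P : Matrix (Fin N) (Fin N) ℝ) (ε : ℝ)
    (s : State n N) (k : ℕ) :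
    run κ f c P ε s (k + 1) = step κ f c P ε (run κ f c P ε s k) :=
  Function.iterate_succ_apply' _ _ _

/-- The columns of `P` sum to one, and the new `v` is exactly the `g` that was added to `y`. -/
lemma xiY_step (hP : IsAverageConsensus G P) (κ : Kind) (f : Fin N → Vec n → ℝ) (c ε : ℝ)
    (s : State n N) : (step κ f c P ε s).xiY = s.xiY := by
  have h := hP.sum_act (fun j => s.y j + gLoc κ (f j) (s.x j) - s.v j)
  simp only [act] at h
  simp only [State.xiY, step, Finset.sum_sub_distrib, h, Finset.sum_add_distrib]
  congr 1
  abel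

lemma xiZ_step (hP : IsAverageConsensus G P) (κ : Kind) (f : Fin N → Vec n → ℝ) (c ε : ℝ)
    (s : State n N) : (step κ f c P ε s).xiZ = s.xiZ := by
  have h := hP.sum_act (fun j => s.z j + hLoc κ (f j) (s.x j) - s.w j)
  simp only [act] at h
  simp only [State.xiZ, step, Finset.sum_sub_distrib, h, Finset.sum_add_distrib]
  congr 1
  abel

lemma xi_run (hP : IsAverageConsensus G P) (κ : Kind) (f : Fin N → Vec n → ℝ) (c ε : ℝ)
    (s : State n N) (k : ℕ) :
    (run κ f c P ε s k).xiY = s.xiY ∧ (run κ f c P ε s k).xiZ = s.xiZ := by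
  induction k with
  | zero => exact ⟨rfl, rfl⟩
  | succ k ih => rw [run_succ, xiY_step hP, xiZ_step hP]; exact ih

/-- Conservation, read at time `k + 1`: from then on `v` holds `g` at the preceding estimates,
whereas its initial value is arbitrary. -/
lemma mean_y_run (hP : IsAverageConsensus G P) (κ : Kind) (f : Fin N → Vec n → ℝ) (c ε : ℝ)
    (s : State n N) (k : ℕ) :
    (1 / (N : ℝ)) • ∑ i, (run κ f c P ε s (k + 1)).y i =
      s.xiY + gBar κ f (WithLp.toLp 2 (run κ f c P ε s k).x) := by
  rw [← (xi_run hP κ f c ε s (k + 1)).1, State.xiY, Finset.sum_sub_distrib, smul_sub, run_succ]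
  exact (sub_add_cancel _ _).symm

lemma mean_z_run (hP : IsAverageConsensus G P) (κ : Kind) (f : Fin N → Vec n → ℝ) (c ε : ℝ)
    (s : State n N) (k : ℕ) :
    (1 / (N : ℝ)) • ∑ i, (run κ f c P ε s (k + 1)).z i =
      s.xiZ + hBar κ f (WithLp.toLp 2 (run κ f c P ε s k).x) := by
  rw [← (xi_run hP κ f c ε s (k + 1)).2, State.xiZ, Finset.sum_sub_distrib, smul_sub, run_succ]
  exact (sub_add_cancel _ _).symm

/-- The messages `(y, z)` exchanged by the agents. -/
def State.msg (s : State n N) : Fin N → Vec n × Mat n := fun i => (s.y i, s.z i)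

/-- The pair `(g i, h i)` at the local estimates `x`. -/
noncomputable def localPair (κ : Kind) (f : Fin N → Vec n → ℝ) (x : Fin N → Vec n) :
    Fin N → Vec n × Mat n :=
  fun i => (gLoc κ (f i) (x i), hLoc κ (f i) (x i))

lemma msg_run (κ : Kind) (f : Fin N → Vec n → ℝ) (c : ℝ) (P : Matrix (Fin N) (Fin N) ℝ) (ε : ℝ)
    (s : State n N) (k : ℕ) :
    (run κ f c P ε s (k + 2)).msg = act P ((run κ f c P ε s (k + 1)).msg +
      (localPair κ f (run κ f c P ε s (k + 1)).x - localPair κ f (run κ f c P ε s k).x)) := by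
  ext1 i
  rw [run_succ κ f c P ε s (k + 1)]
  have hv : (run κ f c P ε s (k + 1)).v = fun i => gLoc κ (f i) ((run κ f c P ε s k).x i) := by
    rw [run_succ]; rfl
  have hw : (run κ f c P ε s (k + 1)).w = fun i => hLoc κ (f i) ((run κ f c P ε s k).x i) := by
    rw [run_succ]; rfl
  simp only [State.msg, step, hv, hw, act, localPair, Pi.add_apply, Pi.sub_apply, Prod.mk_sub_mk,
    Prod.mk_add_mk, Prod.smul_mk, add_sub_assoc]
  exact Prod.ext (by simp only [Prod.fst_sum]) (by simp only [Prod.snd_sum])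

lemma dev_msg_run (hP : IsAverageConsensus G P) (κ : Kind) (f : Fin N → Vec n → ℝ) (c ε : ℝ)
    (s : State n N) (k : ℕ) (i : Fin N) :
    dev (run κ f c P ε s (k + 1)).msg i =
      ((run κ f c P ε s (k + 1)).y i -
          (s.xiY + gBar κ f (WithLp.toLp 2 (run κ f c P ε s k).x)),
        (run κ f c P ε s (k + 1)).z i -
          (s.xiZ + hBar κ f (WithLp.toLp 2 (run κ f c P ε s k).x))) := by
  rw [← mean_y_run hP, ← mean_z_run hP]
  refine Prod.ext ?_ ?_
  · simp only [dev, State.msg, Prod.fst_sub, Prod.smul_fst, Prod.fst_sum]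
  · simp only [dev, State.msg, Prod.snd_sub, Prod.smul_snd, Prod.snd_sum]

end Algorithm

/-! ### The Newton step and its perturbation in the original coordinates. -/

variable {n N : ℕ} {κ : Kind} {f : Fin N → Vec n → ℝ} {c m : ℝ} {xstar : Vec n}

/-- The global bounds, in the coordinates of the algorithm. -/
lemma GlobalProperties.exists_bounds (hf : ∀ i, ContDiff ℝ 3 (f i)) (hc : 0 < c) (hm : 0 < m)
    (h : GlobalProperties κ (shiftCost f xstar) c m) :
    ∃ B L : ℝ, 0 < B ∧ 0 < L ∧
      (∀ X : Stack n N, QuadLE (c • (1 : Mat n)) (hBar κ f X)) ∧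
      (∀ X : Stack n N, ‖hBar κ f X‖ ≤ B) ∧ (∀ X : Stack n N, ‖gBar κ f X‖ ≤ B) ∧
      (∀ x x', ‖localPair κ f x - localPair κ f x'‖ ≤ L * ‖x - x'‖) ∧
      ∀ X X' : Stack n N, ‖psi κ f X - psi κ f X'‖ ≤ L * ‖X - X'‖ := by
  obtain ⟨mg, ag, ah, aψ, hmg, hag, hah, haψ, hh, hg, hgL, hhL, hψ⟩ := h
  have hcan : ∀ X : Stack n N, X - ones N xstar + ones N xstar = X := fun X => sub_add_cancel _ _
  have hlow : ∀ X : Stack n N, QuadLE (c • (1 : Mat n)) (hBar κ f X) := fun X => by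
    have := (hh (X - ones N xstar)).1
    rwa [hBar_shiftCost, hcan] at this
  have hup : ∀ X : Stack n N, QuadLE (hBar κ f X) (m • (1 : Mat n)) := fun X => by
    have := (hh (X - ones N xstar)).2
    rwa [hBar_shiftCost, hcan] at this
  have hnorm : ∀ X : Stack n N, ‖hBar κ f X‖ ≤ n * m := fun X => by
    refine norm_le_of_isSymm (hBar_isSymm κ hf X) ?_ hm.le (hup X)
    rw [quadLE_smul_one_iff]
    intro x
    exact le_trans (by rw [zero_mul]; positivity) (quadLE_smul_one_iff.1 (hlow X) x)
  have hloc : ∀ i x x', ‖hLoc κ (f i) x - hLoc κ (f i) x'‖ ≤ ah * ‖x - x'‖ := fun i x x' => by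
    have := hhL i (x - xstar) (x' - xstar)
    simpa [hLoc_shiftCost] using this
  -- Undoing the translation adds `h i` applied to `xstar`, hence the extra `ah * ‖xstar‖`.
  have gloc : ∀ i x x', ‖gLoc κ (f i) x - gLoc κ (f i) x'‖ ≤ (ag + ah * ‖xstar‖) * ‖x - x'‖ :=
    fun i x x' => by
    have h1 := hgL i (x - xstar) (x' - xstar)
    simp only [gLoc_shiftCost, sub_add_cancel, sub_sub_sub_cancel_right] at h1
    have h2 := norm_mv_le (hLoc κ (f i) x - hLoc κ (f i) x') xstar
    have h3 : ‖hLoc κ (f i) x - hLoc κ (f i) x'‖ * ‖xstar‖ ≤ ah * ‖x - x'‖ * ‖xstar‖ := by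
      gcongr; exact hloc i x x'
    have h4 : gLoc κ (f i) x - gLoc κ (f i) x' = (gLoc κ (f i) x - mv (hLoc κ (f i) x) xstar -
        (gLoc κ (f i) x' - mv (hLoc κ (f i) x') xstar)) +
        mv (hLoc κ (f i) x - hLoc κ (f i) x') xstar := by
      rw [sub_mv]; abel
    rw [h4]
    refine (norm_add_le _ _).trans ?_
    linarith
  refine ⟨mg + n * m * (1 + ‖xstar‖), ag + ah * ‖xstar‖ + ah + aψ, by positivity, by positivity,
    hlow, fun X => ?_, fun X => ?_, fun x x' => ?_, fun X X' => ?_⟩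
  · have : 0 ≤ n * m * ‖xstar‖ := by positivity
    linarith [hnorm X]
  · have h1 := hg (X - ones N xstar)
    rw [gBar_shiftCost, hcan] at h1
    have h2 := norm_mv_le (hBar κ f X) xstar
    have h3 : ‖hBar κ f X‖ * ‖xstar‖ ≤ n * m * ‖xstar‖ := by gcongr; exact hnorm X
    have h4 := norm_le_norm_sub_add (gBar κ f X) (mv (hBar κ f X) xstar)
    have : 0 ≤ n * m := by positivity
    linarith
  · rw [pi_norm_le_iff_of_nonneg (by positivity)]
    intro i
    have hx : ‖x i - x' i‖ ≤ ‖x - x'‖ := norm_le_pi_norm (x - x') i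
    refine max_le ?_ ?_
    · refine (gloc i (x i) (x' i)).trans (mul_le_mul ?_ hx (norm_nonneg _) (by positivity))
      linarith
    · refine (hloc i (x i) (x' i)).trans ?_
      gcongr
      have : 0 ≤ ah * ‖xstar‖ := by positivity
      linarith
  · have h1 := hψ (X - ones N xstar) (X' - ones N xstar)
    rw [psi_shiftCost κ f hc xstar (by rw [hcan]; exact hlow X),
      psi_shiftCost κ f hc xstar (by rw [hcan]; exact hlow X'), hcan, hcan,
      sub_sub_sub_cancel_right, sub_sub_sub_cancel_right] at h1
    refine h1.trans ?_
    gcongr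
    have : 0 ≤ ah * ‖xstar‖ := by positivity
    linarith

/-- On the consensus subspace `ψ` is the Newton-Raphson step of the global cost. -/
lemma psi_ones (hf : ∀ i, ContDiff ℝ 3 (f i)) (hc : 0 < c) {x : Vec n}
    (h : QuadLE (c • (1 : Mat n)) (hBar κ f (ones N x))) :
    psi κ f (ones N x) = x - mv (hBar κ f (ones N x))⁻¹ (gradient (avgCost f) x) := by
  rw [psi, gBar_ones κ hf, mv_sub, h.mv_inv_mv hc]

/-- Coercivity is applied to `w = A⁻¹ v`, and `‖v‖ ≤ B ‖w‖` brings back `v`; no symmetry is needed.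
-/
lemma inner_neg_mv_inv_le {A : Mat n} {B : ℝ} (hc : 0 < c) (hB : 0 < B)
    (hA : QuadLE (c • (1 : Mat n)) A) (hAB : ‖A‖ ≤ B) (v : Vec n) :
    inner ℝ v (-mv A⁻¹ v) ≤ -(c / B ^ 2) * ‖v‖ ^ 2 := by
  set w := mv A⁻¹ v with hw
  have hv : mv A w = v := hA.mv_mv_inv hc v
  have h1 : c * ‖w‖ ^ 2 ≤ inner ℝ v w := by
    have := quadLE_smul_one_iff.1 hA w
    rwa [hv, real_inner_comm] at this
  have h2 : ‖v‖ ≤ B * ‖w‖ := by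
    rw [← hv]; exact (norm_mv_le _ _).trans (by gcongr)
  have h3 : c / B ^ 2 * ‖v‖ ^ 2 ≤ c * ‖w‖ ^ 2 := by
    calc c / B ^ 2 * ‖v‖ ^ 2 ≤ c / B ^ 2 * (B * ‖w‖) ^ 2 := by gcongr
      _ = _ := by field_simp
  rw [inner_neg_right]
  linarith

/-- Near the equilibrium `p` of the perturbed field, the perturbed Newton-Raphson step differs
from the unperturbed one by a small relative error. -/
lemma perturbed_step_bound (hN : 0 < N) (hf : ∀ i, ContDiff ℝ 3 (f i)) (hc : 0 < c)
    (hlow : ∀ X : Stack n N, QuadLE (c • (1 : Mat n)) (hBar κ f X)) {ξy : Vec n} {ξz : Mat n}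
    (hξz : ‖ξz‖ ≤ c / 2) {p : Vec n} (hp : gradient (avgCost f) p + mv ξz p = ξy) {δ : ℝ}
    (hδ : ∀ e : Vec n, phi κ (shiftCost f xstar) c xstar (ones N e) ξy ξz = 0 →
      ∀ X : Stack n N, ‖phi κ (shiftCost f xstar) c xstar (X + ones N e) ξy ξz -
        phi κ (shiftCost f xstar) c xstar X 0 0‖ ≤ δ * ‖X‖) (Y : Fin N → Vec n) :
    ‖(mv (ξz + hBar κ f (WithLp.toLp 2 Y))⁻¹ (ξy + gBar κ f (WithLp.toLp 2 Y)) - p) -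
      (psi κ f (WithLp.toLp 2 fun i => Y i - p + xstar) - xstar)‖ ≤
      δ * ‖(WithLp.toLp 2 fun i => Y i - p : Stack n N)‖ := by
  have hcoer : ∀ X : Stack n N, QuadLE ((c / 2) • (1 : Mat n)) (ξz + hBar κ f X) := fun X =>
    (hlow X).add_of_norm_le (by linarith)
  have hcoer0 : ∀ X : Stack n N, QuadLE ((c / 2) • (1 : Mat n)) (0 + hBar κ f X) := fun X =>
    (hlow X).add_of_norm_le (by rw [norm_zero]; linarith)
  have hsum : ones N (p - xstar) + ones N xstar = ones N p := by
    ext i : 1; simp [ones]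
  -- The equation for `p` says that `ξy + gBar = (ξz + hBar) p` at consensus, and the threshold is
  -- inactive because `‖ξz‖ ≤ c / 2`.
  have heq : phi κ (shiftCost f xstar) c xstar (ones N (p - xstar)) ξy ξz = 0 := by
    ext i : 1
    rw [phi_shiftCost_apply, hsum, thr_of_quadLE (hcoer _), gBar_ones κ hf]
    have h1 : ξy + (mv (hBar κ f (ones N p)) p - gradient (avgCost f) p) =
        mv (ξz + hBar κ f (ones N p)) p := by
      rw [← hp, add_mv]; abel
    rw [h1, (hcoer _).mv_inv_mv (by positivity)]
    simp [ones]
  have h2 := hδ _ heq (WithLp.toLp 2 fun i => Y i - p)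
  refine le_trans ?_ h2
  have h3 : (WithLp.toLp 2 fun i => Y i - p : Stack n N) + ones N (p - xstar) + ones N xstar =
      WithLp.toLp 2 Y := by
    ext i : 1; simp [ones]
  have h4 : (WithLp.toLp 2 fun i => Y i - p : Stack n N) + ones N xstar =
      WithLp.toLp 2 fun i => Y i - p + xstar := by
    ext i : 1; simp [ones]
  -- Apart from `-X i`, all blocks of `phi` agree, and that term cancels up to a constant; any
  -- single block gives the claim.
  refine le_trans (le_of_eq ?_) (PiLp.norm_apply_le _ (⟨0, hN⟩ : Fin N))
  rw [PiLp.sub_apply, phi_shiftCost_apply, phi_shiftCost_apply, h3, h4, thr_of_quadLE (hcoer _),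
    thr_of_quadLE (hcoer0 _), zero_add, zero_add, psi]
  congr 1
  simp only [ones, PiLp.add_apply]
  abel

end NRC

/-! ### Assembly of the theorem. -/

open NRC in
theorem mainTheorem2 (n N : ℕ) (G : SimpleGraph (Fin N)) (P : Matrix (Fin N) (Fin N) ℝ)
    (hP : NRC.IsAverageConsensus G P)
    (κ : NRC.Kind) (f : Fin N → NRC.Vec n → ℝ) (c m : ℝ) (xstar : NRC.Vec n)
    (hmin : IsMinOn (NRC.avgCost f) Set.univ xstar)
    (h₁ : NRC.Convexity f c m)
    (h₂ : NRC.GlobalProperties κ (NRC.shiftCost f xstar) c m)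
    (h₃ : NRC.GlobalLipschitzPerturbation κ (NRC.shiftCost f xstar) c xstar) :
    ∃ a r εbar : ℝ, 0 < a ∧ 0 < r ∧ 0 < εbar ∧
      ∃ Ψ : NRC.Vec n × NRC.Mat n → NRC.Vec n,
        ContDiff ℝ 1 Ψ ∧
        (∀ (ξy : NRC.Vec n) (ξz : NRC.Mat n), ‖Ψ (ξy, ξz) - xstar‖ ≤ a * (‖ξy‖ + ‖ξz‖)) ∧
        ∀ ε ∈ Set.Ioo 0 εbar, ∃ γ ∈ Set.Ioo (0 : ℝ) 1,
          ∀ s : NRC.State n N, ‖s.xiY‖ + ‖s.xiZ‖ ≤ r →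
            (∀ i, Tendsto (fun k => (NRC.run κ f c P ε s k).x i) atTop
              (𝓝 (Ψ (s.xiY, s.xiZ)))) ∧
            ∃ C : ℝ, ∀ (k : ℕ) (i : Fin N),
              ‖(NRC.run κ f c P ε s k).x i - Ψ (s.xiY, s.xiZ)‖ ≤ C * γ ^ k := by
  obtain ⟨hf, hc, hm, hlo, hup⟩ := h₁
  have hN := hP.pos
  obtain ⟨B, L, hB, hL, hlow, hhB, hgB, hLoc, hψ⟩ := h₂.exists_bounds hf hc hm
  obtain ⟨aξ, r₃, haξ, hr₃, hpert⟩ := h₃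
  have hF3 := contDiff_avgCost hf
  have hgs := contDiff_gradient hF3
  have hF : ∀ x, HasGradientAt (avgCost f) (gradient (avgCost f) x) x := fun x =>
    (hF3.differentiable three_ne_zero x).hasGradientAt
  have hg : ∀ x, HasFDerivAt (gradient (avgCost f)) (fderiv ℝ (gradient (avgCost f)) x) x :=
    fun x => (hgs.differentiable two_ne_zero x).hasFDerivAt
  have hclow : ∀ x d, c * ‖d‖ ^ 2 ≤ inner ℝ d (fderiv ℝ (gradient (avgCost f)) x d) :=
    fun x d => by rw [← mv_hessian]; exact quadLE_smul_one_iff.1 (hlo x) d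
  have hmup : ∀ x d, inner ℝ d (fderiv ℝ (gradient (avgCost f)) x d) ≤ m * ‖d‖ ^ 2 :=
    fun x d => by rw [← mv_hessian]; exact quadLE_smul_one_iff'.1 (hup x) d
  have hmin' : ∀ x, avgCost f xstar ≤ avgCost f x := fun x => hmin (Set.mem_univ x)
  have hg0 : gradient (avgCost f) xstar = 0 := by
    have : IsLocalMin (avgCost f) xstar := Eventually.of_forall hmin'
    rw [gradient, this.fderiv_eq_zero, map_zero]
  obtain ⟨a, r₂, ha, hr₂, Ψ, hΨ, hΨa, hΨeq⟩ := exists_equilibrium hc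
    (hgs.of_le one_le_two) (strongly_monotone hF hg hclow) hclow hg0
  obtain ⟨V, KV, ρ, hKV, hρ0, hρ, hVge, hVle, hVadd, hVact⟩ :=
    exists_adapted_norm hP.tendsto_sub_pow (Vec n × Mat n)
  obtain ⟨K₁, hK₁, hthr⟩ := exists_norm_thr_inv_sub_le n hc (B := 1 + B) (by positivity)
  set ψ : (Fin N → Vec n) → Vec n := fun X => psi κ f (WithLp.toLp 2 X) with hψdef
  have hψL : ∀ X X', ‖ψ X - ψ X'‖ ≤ L * √N * ‖X - X'‖ := fun X X' => by
    refine (hψ _ _).trans ?_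
    rw [← WithLp.toLp_sub, mul_assoc]
    gcongr
    exact norm_stack_le _
  have hψ1 : ∀ x, ψ (fun _ => x) - x =
      -mv (hBar κ f (ones N x))⁻¹ (gradient (avgCost f) x) := fun x => by
    have := psi_ones hf hc (hlow (ones N x))
    rw [show ψ (fun _ => x) = psi κ f (ones N x) from rfl, this]
    abel
  obtain ⟨r₁, εbar, hr₁, hεbar, htrack⟩ := exists_tracking hN hF hg hc hm hclow hmup hmin' hg0
    (b := c / B ^ 2) (B := 1 / c) (L := L * √N) (K := K₁ + KV * L) (ρ := ρ) (ψ := ψ)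
    (by positivity) (by positivity) (by positivity) hρ0 hρ hψL
    (fun x => by rw [hψ1]; exact inner_neg_mv_inv_le hc hB (hlow _) (hhB _) _)
    (fun x => by rw [hψ1, norm_neg]; exact (hlow _).norm_mv_inv_le hc _)
  -- The radius keeps the means bounded by `1 + B`, keeps `ξz + hBar ≥ 3c/4`, stays in the domains
  -- of the equilibrium equation and of Assumption 3, and brings the relative error below `r₁`. The
  -- factor `√N` compares sup and Euclidean norms.
  refine ⟨a, min (min 1 (c / 4)) (min r₂ (min r₃ (r₁ / (aξ * √N + 1)))), εbar, ha,
    by positivity, hεbar, Ψ, hΨ, hΨa, fun ε hε => ?_⟩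
  obtain ⟨γ, hγ, htrack⟩ := htrack ε hε
  refine ⟨γ, hγ, fun s hs => ?_⟩
  simp only [le_min_iff] at hs
  obtain ⟨⟨hs1, hsc⟩, hs2, hs3, hs4⟩ := hs
  rw [le_div_iff₀ (by positivity)] at hs4
  have hyn := norm_nonneg s.xiY
  have hzn := norm_nonneg s.xiZ
  set p := Ψ (s.xiY, s.xiZ) with hp
  have hsqrt : √(‖s.xiY‖ ^ 2 + ‖s.xiZ‖ ^ 2) ≤ ‖s.xiY‖ + ‖s.xiZ‖ :=
    Real.sqrt_le_iff.2 ⟨by positivity, by nlinarith⟩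
  set X : ℕ → Fin N → Vec n := fun k => (run κ f c P ε s k).x with hX
  have hcoer : ∀ Y : Stack n N, QuadLE ((3 * c / 4) • (1 : Mat n)) (s.xiZ + hBar κ f Y) :=
    fun Y => (hlow Y).add_of_norm_le (by linarith)
  -- The target is the step formed from the exact means, `η` is the error of the local copies, and
  -- `Q` is the adapted norm of the message deviation at time `k + 1`.
  obtain ⟨C, hC⟩ := htrack p
    (fun k => mv (s.xiZ + hBar κ f (WithLp.toLp 2 (X k)))⁻¹
      (s.xiY + gBar κ f (WithLp.toLp 2 (X k)))) X
    (fun k i => mv (thr c ((run κ f c P ε s (k + 1)).z i))⁻¹ ((run κ f c P ε s (k + 1)).y i) -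
      mv (s.xiZ + hBar κ f (WithLp.toLp 2 (X k)))⁻¹ (s.xiY + gBar κ f (WithLp.toLp 2 (X k))))
    (fun k => V (dev (run κ f c P ε s (k + 1)).msg))
    (fun k => (norm_nonneg _).trans (hVge _))
    (fun k i => by
      rw [add_sub_cancel]
      simp only [hX]
      rw [run_succ κ f c P ε s (k + 1)]
      rfl)
    (fun k => by
      have hV0 := (norm_nonneg _).trans (hVge (dev (run κ f c P ε s (k + 1)).msg))
      rw [pi_norm_le_iff_of_nonneg (by positivity)]
      intro i
      refine (hthr _ _ _ _ (hcoer _) ?_ ?_).trans ?_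
      · exact (norm_add_le _ _).trans (add_le_add (by linarith) (hhB _))
      · exact (norm_add_le _ _).trans (add_le_add (by linarith) (hgB _))
      · have h1 := (norm_le_pi_norm _ i).trans (hVge (dev (run κ f c P ε s (k + 1)).msg))
        rw [dev_msg_run hP, Prod.norm_def] at h1
        calc _ ≤ K₁ * V (dev (run κ f c P ε s (k + 1)).msg) := by gcongr
          _ ≤ _ := by
            gcongr
            have : 0 ≤ KV * L := by positivity
            linarith)
    (fun k => by
      refine (perturbed_step_bound hN hf hc hlow (by linarith) (hΨeq _ _ hs2)
        (hpert s.xiY s.xiZ (hsqrt.trans hs3)) (X k)).trans ?_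
      calc _ ≤ aξ * (‖s.xiY‖ + ‖s.xiZ‖) * (√N * ‖fun i => X k i - p‖) := by
            gcongr; exact norm_stack_le _
        _ = (‖s.xiY‖ + ‖s.xiZ‖) * (aξ * √N) * ‖fun i => X k i - p‖ := by ring
        _ ≤ _ := by gcongr; linarith)
    (fun k => by
      rw [msg_run, hP.dev_act]
      refine (hVact _).trans ?_
      gcongr
      refine (hVadd _ _).trans ?_
      gcongr
      calc _ ≤ KV * (L * ‖X (k + 1) - X k‖) :=
            (hVle _).trans (by gcongr; exact hLoc _ _)
        _ ≤ _ := by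
            rw [← mul_assoc]
            gcongr
            linarith)
  have hC0 : 0 ≤ C := by simpa using (norm_nonneg _).trans (hC 0)
  have hγ0 : γ ≠ 0 := hγ.1.ne'
  -- The tracking bound starts at time `1`: dividing `C` by `γ` shifts the index, and the initial
  -- error covers time `0`.
  have hbound : ∀ k i, ‖X k i - p‖ ≤ (‖fun i => X 0 i - p‖ + C / γ) * γ ^ k := by
    have hγ1 := hγ.1
    intro k i
    rcases k with _ | k
    · have h1 : 0 ≤ C / γ := by positivity
      have h2 := norm_le_pi_norm (fun i => X 0 i - p) i
      rw [pow_zero, mul_one]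
      exact h2.trans (by linarith)
    · calc ‖X (k + 1) i - p‖ ≤ ‖fun i => X (k + 1) i - p‖ :=
            norm_le_pi_norm (fun i => X (k + 1) i - p) i
        _ ≤ C * γ ^ k := hC k
        _ = C / γ * γ ^ (k + 1) := by rw [pow_succ]; field_simp
        _ ≤ _ := by gcongr; linarith [norm_nonneg fun i => X 0 i - p]
  refine ⟨fun i => ?_, _, hbound⟩
  rw [tendsto_iff_norm_sub_tendsto_zero]
  refine squeeze_zero (fun k => norm_nonneg _) (fun k => hbound k i) ?_
  simpa using (tendsto_pow_atTop_nhds_zero_of_lt_one hγ.1.le hγ.2).const_mul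
    (‖fun i => X 0 i - p‖ + C / γ)
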